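/- For $\sigma>0$ and $k\in\mathbb C$ let $R(k)=(\Delta^2-k^2-ik\sigma)^{-1}$ denote the bounded inverse on $L^2(\mathbb R^3)$ of the operator $\Delta^2-k^2-ik\sigma$ with domain $H^4(\mathbb R^3)$, whenever it exists. For $\delta,d>0$ let $\mathcal R_{\delta,d}=\{k\in\mathbb C:\ \operatorname{Re}k>\delta,\ |\operatorname{Im}k|<d\}$, and for $R>0$ let $B_R=\{x\in\mathbb R^3:|x|<R\}$. Let $\delta>0$. For every $\sigma>0$ there is $d_0=d_0(\sigma,\delta)>0$ such that for every $d\in(0,d_0]$ the resolvent $R(k)$ exists for all $k\in\mathcal R_{\delta,d}$, and $k\mapsto R(k)$ is analytic on $\mathcal R_{\delta,d}$ with values in the bounded operators on $L^2(\mathbb R^3)$. Moreover, for every $R>0$ and every $\rho\in C_0^\infty(B_R)$ there is a constant $C>0$, depending only on $\delta$, $R$ and $\rho$ (and not on $\sigma$, $d$ or $k$), such that for all $\sigma>0$, all $d\in(0,d_0(\sigma,\delta)]$ and all $j\in\{0,1,2,3,4\}$ the cut-off resolvent $\rho R(k)\rho$ maps $L^2(B_R)$ boundedly into $H^j(B_R)$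 for all $k\in\mathcal R_{\delta,d}$, is analytic in $k\in\mathcal R_{\delta,d}$ as a function with values in the bounded operators $L^2(B_R)\to H^j(B_R)$, and satisfies $$\|\rho R(k)\rho\|_{L^2(B_R)\to H^j(B_R)}\le C\,|k|^{j/2}\,e^{2R(\sigma+1)|k|^{1/2}}\qquad\text{for all }k\in\mathcal R_{\delta,d}.$$ -/

import Mathlib

open MeasureTheory Set Metric
open scoped ContDiff Distributions SchwartzMap Laplacian LineDeriv

noncomputable section

namespace PlateResolvent

/-- Three-dimensional Euclidean space. -/
abbrev E3 : Type := EuclideanSpace ℝ (Fin 3)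

/-- The complex Hilbert space `L²(ℝ³)`. -/
abbrev L2 : Type := Lp ℂ 2 (volume : Measure E3)

/-- The open ball `B_R` of radius `R` about the origin of `ℝ³`. -/
def ballOpen (R : ℝ) : TopologicalSpace.Opens E3 := ⟨ball (0 : E3) R, isOpen_ball⟩

/-- The complex Hilbert space `L²(B_R)`. -/
abbrev L2Ball (R : ℝ) : Type := Lp ℂ 2 (volume.restrict (ball (0 : E3) R))

/-! ### The Sobolev spaces `H^j(B_R)` -/

/-- Multi-indices `α = (α₁, α₂, α₃)` with `|α| ≤ j`. -/
abbrev MultiIndex (j : ℕ) : Type := {α : Fin 3 → Fin (j + 1) // ∑ i, (α i : ℕ) ≤ j}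

/-- The order `|α|`. -/
def MultiIndex.order {j : ℕ} (α : MultiIndex j) : ℕ := ∑ i, (α.1 i : ℕ)

/-- The multi-index `0`. -/
def MultiIndex.zero (j : ℕ) : MultiIndex j := ⟨fun _ => 0, by simp⟩

/-- The partial derivative `∂/∂x_i` of a test function. -/
def pderiv {R : ℝ} (i : Fin 3) (φ : 𝓓(ballOpen R, ℝ)) : 𝓓(ballOpen R, ℝ) :=
  ∂_{(EuclideanSpace.single i (1 : ℝ) : E3)} φ

/-- The derivative `∂^α φ` of a test function. -/
def mderiv {R : ℝ} {j : ℕ} (α : MultiIndex j) (φ : 𝓓(ballOpen R, ℝ)) : 𝓓(ballOpen R, ℝ) :=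
  (pderiv 0)^[(α.1 0 : ℕ)] ((pderiv 1)^[(α.1 1 : ℕ)] ((pderiv 2)^[(α.1 2 : ℕ)] φ))

/-- `v` is the weak derivative `∂^α u` in `B_R`. -/
def IsWeakDeriv {R : ℝ} {j : ℕ} (α : MultiIndex j) (u v : L2Ball R) : Prop :=
  ∀ φ : 𝓓(ballOpen R, ℝ),
    ∫ x in ball (0 : E3) R, mderiv α φ x • u x =
      (-1 : ℂ) ^ α.order * ∫ x in ball (0 : E3) R, φ x • v x

theorem integrable_test_smul {R : ℝ} (φ : 𝓓(ballOpen R, ℝ)) (u : L2Ball R) :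
    Integrable (fun x => φ x • u x) (volume.restrict (ball (0 : E3) R)) := by
  have hu : Integrable u (volume.restrict (ball (0 : E3) R)) := by
    have : IsFiniteMeasure (volume.restrict (ball (0 : E3) R)) :=
      ⟨by simpa using measure_ball_lt_top (μ := (volume : Measure E3)) (x := (0 : E3)) (r := R)⟩
    exact (Lp.memLp u).integrable (by norm_num)
  have h := (Integrable.smul_of_top_right (μ := volume.restrict (ball (0 : E3) R))
    (f := u) (φ := φ) hu φ.memLp_top)
  exact h

/-- The Sobolev space `H^j(B_R)`. An element is the family `(∂^α u)_{|α| ≤ j}` of all weak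
derivatives of a function `u ∈ L²(B_R)` (which is the member with `α = 0`), these being required to
exist in `L²(B_R)`; the norm is `(∑_{|α| ≤ j} ‖∂^α u‖²_{L²(B_R)})^{1/2}`. -/
def sobolevBall (R : ℝ) (j : ℕ) :
    Submodule ℂ (PiLp 2 (fun _ : MultiIndex j => L2Ball R)) where
  carrier := {U | ∀ α : MultiIndex j, IsWeakDeriv α (U (MultiIndex.zero j)) (U α)}
  add_mem' := by
    intro U V hU hV α φ
    have key : ∀ (ψ : 𝓓(ballOpen R, ℝ)) (u v : L2Ball R),
        ∫ x in ball (0 : E3) R, ψ x • (u + v : L2Ball R) x =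
          (∫ x in ball (0 : E3) R, ψ x • u x) + ∫ x in ball (0 : E3) R, ψ x • v x := by
      intro ψ u v
      rw [← integral_add (integrable_test_smul ψ u) (integrable_test_smul ψ v)]
      refine integral_congr_ae ?_
      filter_upwards [Lp.coeFn_add u v] with x hx
      rw [hx, Pi.add_apply, smul_add]
    rw [PiLp.add_apply, PiLp.add_apply, key, key, hU α φ, hV α φ, mul_add]
  zero_mem' := by
    intro α φ
    have key : ∀ ψ : 𝓓(ballOpen R, ℝ),
        ∫ x in ball (0 : E3) R, ψ x • (0 : L2Ball R) x = 0 := by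
      intro ψ
      rw [← integral_zero E3 ℂ (μ := volume.restrict (ball (0 : E3) R))]
      refine integral_congr_ae ?_
      filter_upwards [Lp.coeFn_zero ℂ 2 (volume.restrict (ball (0 : E3) R))] with x hx
      rw [hx]
      simp
    rw [PiLp.zero_apply, PiLp.zero_apply, key, key, mul_zero]
  smul_mem' := by
    intro c U hU α φ
    have key : ∀ (ψ : 𝓓(ballOpen R, ℝ)) (u : L2Ball R),
        ∫ x in ball (0 : E3) R, ψ x • (c • u : L2Ball R) x =
          c * ∫ x in ball (0 : E3) R, ψ x • u x := by
      intro ψ u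
      rw [← integral_const_mul]
      refine integral_congr_ae ?_
      filter_upwards [Lp.coeFn_smul c u] with x hx
      rw [hx, Pi.smul_apply, smul_eq_mul, mul_smul_comm]
    rw [PiLp.smul_apply, PiLp.smul_apply, key, key, hU α φ]
    ring

/-- The inclusion `H^j(B_R) → L²(B_R)`. -/
def sobolevToL2 {R : ℝ} {j : ℕ} (U : sobolevBall R j) : L2Ball R :=
  (U : PiLp 2 (fun _ : MultiIndex j => L2Ball R)) (MultiIndex.zero j)

/-! ### The resolvent of the bi-Laplacian on `ℝ³` -/

/-- `T = (Δ² - z)⁻¹`, where `Δ²` is the operator on `L²(ℝ³)` with domain `H⁴(ℝ³)`, acting in the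
sense of tempered distributions: `T` maps `L²(ℝ³)` into `H⁴(ℝ³)` and is a right and left inverse
of `Δ² - z`. -/
structure IsResolventAt (z : ℂ) (T : L2 →L[ℂ] L2) : Prop where
  mem_domain : ∀ f : L2, TemperedDistribution.MemSobolev 4 2 (T f : 𝓢'(E3, ℂ))
  right_inv : ∀ f : L2,
    Δ (Δ (T f : 𝓢'(E3, ℂ))) - z • (T f : 𝓢'(E3, ℂ)) = (f : 𝓢'(E3, ℂ))
  left_inv : ∀ u f : L2, TemperedDistribution.MemSobolev 4 2 (u : 𝓢'(E3, ℂ)) →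
    Δ (Δ (u : 𝓢'(E3, ℂ))) - z • (u : 𝓢'(E3, ℂ)) = (f : 𝓢'(E3, ℂ)) → T f = u

open Classical in
/-- The resolvent `(Δ² - z)⁻¹` (with the value `0` where `Δ² - z` has no bounded inverse). -/
def biharmonicResolvent (z : ℂ) : L2 →L[ℂ] L2 :=
  if h : ∃ T : L2 →L[ℂ] L2, IsResolventAt z T then h.choose else 0

/-- The resolvent `R(k) = (Δ² - k² - i k σ)⁻¹` of the damped plate operator. -/
def plateResolvent (σ : ℝ) (k : ℂ) : L2 →L[ℂ] L2 :=
  biharmonicResolvent (k ^ 2 + Complex.I * k * σ)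

/-! ### The cut-off resolvent -/

/-- Extension by zero `L²(B_R) → L²(ℝ³)`. -/
def extendByZero {R : ℝ} (g : L2Ball R) : L2 :=
  ((memLp_indicator_iff_restrict measurableSet_ball).2 (Lp.memLp g)).toLp
    ((ball (0 : E3) R).indicator g)

/-- Multiplication by the test function `ρ` on `L²(ℝ³)`. -/
def mulTest {R : ℝ} (ρ : 𝓓(ballOpen R, ℂ)) (u : L2) : L2 :=
  (ρ.memLp_top (μ := (volume : Measure E3))).toLp ρ • u

/-- The cut-off resolvent `ρ R(k) ρ`, as a map from `L²(B_R)` to `L²(B_R)`. -/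
def cutoffResolvent {R : ℝ} (ρ : 𝓓(ballOpen R, ℂ)) (σ : ℝ) (k : ℂ) (g : L2Ball R) : L2Ball R :=
  LpToLpRestrictCLM E3 ℂ ℂ volume 2 (ball (0 : E3) R)
    (mulTest ρ (plateResolvent σ k (mulTest ρ (extendByZero g))))

/-- The rectangular slab `(δ, ∞) × (-d, d)` in the complex plane. -/
def slab (δ d : ℝ) : Set ℂ := {k | δ < k.re ∧ -d < k.im ∧ k.im < d}

end PlateResolvent

end

/-! Put z = k² + ikσ. Its imaginary part is Re k (2 Im k + σ), which is positive on the slab once d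
≤ σ/4. So z avoids the spectrum [0, ∞), the resolvent is the Fourier multiplier 1/((2π|ξ|)⁴ - z),
and the first resolvent identity makes it analytic.

The quantitative bound must not degenerate as z approaches the real axis, so the L² norm of the
multiplier is useless for it. Write z = λ⁴ with λ in the open first quadrant. The Green function
(e^{iλr} - e^{-λr}) / (8πλ²r) is bounded by 1/(4π|λ|), because the two 1/r singularities cancel
(`norm_green_le`). For a derivative ∂^β of the resolvent the symbol is split at frequency |λ|. The
low part is the Green function convolved with a kernel of L¹ norm C|λ|^{|β|}; it is therefore
bounded from L¹ to L^∞, which suffices on a ball. The high part has symbol at most 2|λ|^{|β|-4}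
(`norm_high_symbol_le`). Together they give `exists_norm_restrict_derivResolvent_le`, in which the
distance from z to the spectrum does not enter.

The Leibniz rule, in weak form, turns this into an H^j bound C|λ|^j for ρR(k)ρ, using |λ| ≥ √δ.
Finally |λ|⁴ = |k||k + iσ| ≤ |k|²(1 + σ/δ), so the bound is C|k|^{j/2}(1 + σ/δ), and the exponential
absorbs 1 + σ/δ (`one_add_div_le_exp`); this makes C independent of σ. Analyticity with values in
H^j follows from that of R(k) on L² through the resolvent identity with base point -1. -/

open scoped FourierTransform ComplexConjugate

noncomputable section

namespace PlateResolvent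

/-! ### The Yukawa potential and its Fourier transform -/

/-- The radial profile `e^{-μ r} / (4 π r)` of the Yukawa potential. -/
def yukawaProfile (μ : ℂ) (r : ℝ) : ℂ := Complex.exp (-μ * r) / (4 * Real.pi * r)

/-- The Yukawa potential `e^{-μ |x|} / (4 π |x|)`. -/
def yukawa (μ : ℂ) (x : E3) : ℂ := yukawaProfile μ ‖x‖

/-- In polar coordinates the weight r² cancels the singularity 1/r and leaves r e^{-r Re μ} up to a
constant. -/
theorem integrable_yukawa {μ : ℂ} (hμ : 0 < μ.re) : Integrable (yukawa μ) := by
  unfold yukawa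
  rw [integrable_fun_norm_addHaar (E := E3) volume]
  have h1 : IntegrableOn (fun y : ℝ => Real.exp (-μ.re * y) * y ^ (1:ℝ)) (Ioi 0) := by
    have := integrableOn_rpow_mul_exp_neg_mul_rpow (p := 1) (s := 1) (b := μ.re) (by norm_num) (by norm_num) hμ
    refine this.congr_fun (fun y hy => ?_) measurableSet_Ioi
    simp [mul_comm]
  refine Integrable.mono' (h1.const_mul (1 / (4 * Real.pi))) ?_ ?_
  · apply Measurable.aestronglyMeasurable
    unfold yukawaProfile
    fun_prop
  · refine (ae_restrict_mem measurableSet_Ioi).mono fun y hy => ?_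
    have hy : (0:ℝ) < y := hy
    have hpi := Real.pi_pos
    unfold yukawaProfile
    simp only [norm_smul, norm_div, Complex.norm_exp, norm_mul, Complex.norm_real,
      Real.norm_eq_abs, norm_pow, finrank_euclideanSpace, Fintype.card_fin, abs_of_pos hy, abs_of_pos hpi]
    simp
    field_simp
    simp

/-- This is the integral of the Yukawa potential over a plane at distance |a| from the origin, with
ℂ as the plane. With q = √(a² + s²) one has s ds = q dq, so the factor 1/q disappears and the
integrand is an exact derivative. The condition a ≠ 0 keeps q differentiable at s = 0. -/
theorem integral_radial_slice {μ : ℂ} (hμ : 0 < μ.re) {a : ℝ} (ha : a ≠ 0) :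
    ∫ y : ℂ, yukawaProfile μ (Real.sqrt (a ^ 2 + ‖y‖ ^ 2)) = Complex.exp (-μ * |a|) / (2 * μ) := by
  have hμ0 : μ ≠ 0 := by rintro rfl; simp at hμ
  have hpi : (Real.pi : ℂ) ≠ 0 := by exact_mod_cast Real.pi_ne_zero
  have hpos : ∀ s : ℝ, 0 < a ^ 2 + s ^ 2 := fun s => by positivity
  have key := integral_fun_norm_addHaar (E := ℂ) volume
    (fun s : ℝ => yukawaProfile μ (Real.sqrt (a ^ 2 + s ^ 2)))
  rw [key]
  have hder : ∀ s ∈ Ici (0:ℝ), HasDerivAt (fun s : ℝ => -Complex.exp (-μ * Real.sqrt (a ^ 2 + s ^ 2)) / (4 * Real.pi * μ))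
      (s ^ (Module.finrank ℝ ℂ - 1) • yukawaProfile μ (Real.sqrt (a ^ 2 + s ^ 2))) s := by
    intro s _
    have h1 : HasDerivAt (fun s : ℝ => Real.sqrt (a ^ 2 + s ^ 2)) (s / Real.sqrt (a ^ 2 + s ^ 2)) s := by
      have := (((hasDerivAt_id s).pow 2).const_add (a ^ 2)).sqrt (hpos s).ne'
      convert! this using 1
      have := (Real.sqrt_pos.2 (hpos s)).ne'
      simp
      field_simp
    have h2 := ((h1.ofReal_comp.const_mul (-μ)).cexp.neg).div_const (4 * Real.pi * μ)
    convert! h2 using 1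
    have : ((Real.sqrt (a ^ 2 + s ^ 2) : ℝ) : ℂ) ≠ 0 := by
      exact_mod_cast (Real.sqrt_pos.2 (hpos s)).ne'
    simp [yukawaProfile, Complex.finrank_real_complex]
    field_simp
  have hle : ∀ s : ℝ, 0 ≤ s → s ≤ Real.sqrt (a ^ 2 + s ^ 2) := fun s hs =>
    Real.le_sqrt_of_sq_le (by nlinarith [sq_nonneg a])
  have hint : IntegrableOn (fun s : ℝ => s ^ (Module.finrank ℝ ℂ - 1) • yukawaProfile μ (Real.sqrt (a ^ 2 + s ^ 2))) (Ioi 0) := by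
    have h1 : IntegrableOn (fun y : ℝ => Real.exp (-μ.re * y)) (Ioi 0) :=
      integrableOn_exp_mul_Ioi (by linarith) 0
    refine Integrable.mono' (h1.const_mul (1 / (4 * Real.pi))) ?_ ?_
    · apply Measurable.aestronglyMeasurable
      unfold yukawaProfile
      fun_prop
    · refine (ae_restrict_mem measurableSet_Ioi).mono fun s hs => ?_
      have hs : (0:ℝ) < s := hs
      have hpi := Real.pi_pos
      have hq := Real.sqrt_pos.2 (hpos s)
      unfold yukawaProfile
      simp only [norm_smul, norm_div, Complex.norm_exp, norm_mul, Complex.norm_real,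
        Real.norm_eq_abs, norm_pow, Complex.finrank_real_complex, abs_of_pos hs, abs_of_pos hpi, abs_of_pos hq]
      simp
      have e1 : Real.exp (-(μ.re * Real.sqrt (a ^ 2 + s ^ 2))) ≤ Real.exp (-(μ.re * s)) := by
        gcongr; exact hle s hs.le
      calc _ = (s / Real.sqrt (a ^ 2 + s ^ 2)) * (Real.exp (-(μ.re * Real.sqrt (a ^ 2 + s ^ 2))) / (4 * Real.pi)) := by field_simp
        _ ≤ 1 * (Real.exp (-(μ.re * s)) / (4 * Real.pi)) := by
          gcongr
          exact (div_le_one hq).2 (hle s hs.le)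
        _ = _ := by field_simp
  have hlim : Filter.Tendsto (fun s : ℝ => -Complex.exp (-μ * Real.sqrt (a ^ 2 + s ^ 2)) / (4 * Real.pi * μ)) Filter.atTop (nhds 0) := by
    have h0 : Filter.Tendsto (fun s : ℝ => Complex.exp (-μ * Real.sqrt (a ^ 2 + s ^ 2))) Filter.atTop (nhds 0) := by
      rw [Complex.tendsto_exp_nhds_zero_iff]
      have : Filter.Tendsto (fun s : ℝ => Real.sqrt (a ^ 2 + s ^ 2)) Filter.atTop Filter.atTop :=
        Filter.tendsto_atTop_mono' _ ((Filter.eventually_ge_atTop 0).mono hle) Filter.tendsto_id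
      simpa using this.const_mul_atTop hμ
    simpa using (h0.neg.div_const (4 * Real.pi * μ))
  rw [integral_Ioi_of_hasDerivAt_of_tendsto' hder hint hlim]
  simp [Complex.finrank_real_complex, Measure.real, Real.sqrt_sq_eq_abs]
  field_simp
  norm_num

theorem integral_exp_neg_abs {μ : ℂ} (hμ : 0 < μ.re) (t : ℝ) :
    ∫ a : ℝ, Complex.exp (-(2 * Real.pi * a * t : ℝ) * Complex.I) * (Complex.exp (-μ * |a|) / (2 * μ)) =
      1 / (μ ^ 2 + (2 * Real.pi * t : ℝ) ^ 2) := by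
  have hμ0 : μ ≠ 0 := by rintro rfl; simp at hμ
  set w : ℂ := (2 * Real.pi * t : ℝ) * Complex.I with hw
  have hwre : w.re = 0 := by simp [hw]
  have hp : (μ + w) ≠ 0 := fun h => by
    have := congrArg Complex.re h; simp [hwre] at this; linarith
  have hm : (μ - w) ≠ 0 := fun h => by
    have := congrArg Complex.re h; simp [hwre] at this; linarith
  have hI : IntegrableOn (fun a : ℝ => Complex.exp ((-(μ + w)) * a)) (Ioi 0) :=
    integrableOn_exp_mul_complex_Ioi (by simp [hwre, hμ]) 0
  have hI' : IntegrableOn (fun a : ℝ => Complex.exp ((μ - w) * a)) (Iic 0) :=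
    integrableOn_exp_mul_complex_Iic (by simp [hwre, hμ]) 0
  have e1 : EqOn (fun a : ℝ => Complex.exp (-(2 * Real.pi * a * t : ℝ) * Complex.I) * (Complex.exp (-μ * |a|) / (2 * μ)))
      (fun a : ℝ => Complex.exp ((-(μ + w)) * a) / (2 * μ)) (Ioi 0) := by
    intro a ha
    have ha : (0:ℝ) < a := ha
    simp only [abs_of_pos ha]
    rw [← mul_div_assoc, ← Complex.exp_add]
    congr 2
    simp only [hw]; push_cast; ring
  have e2 : EqOn (fun a : ℝ => Complex.exp (-(2 * Real.pi * a * t : ℝ) * Complex.I) * (Complex.exp (-μ * |a|) / (2 * μ)))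
      (fun a : ℝ => Complex.exp ((μ - w) * a) / (2 * μ)) (Iic 0) := by
    intro a ha
    have ha : a ≤ 0 := ha
    simp only [abs_of_nonpos ha]
    rw [← mul_div_assoc, ← Complex.exp_add]
    congr 2
    simp only [hw]; push_cast; ring
  rw [← intervalIntegral.integral_Iic_add_Ioi (b := 0), setIntegral_congr_fun measurableSet_Ioi e1,
    setIntegral_congr_fun measurableSet_Iic e2, integral_div, integral_div,
    integral_exp_mul_complex_Ioi (by simp [hwre, hμ]), integral_exp_mul_complex_Iic (by simp [hwre, hμ])]
  · have : μ ^ 2 + ((2 * Real.pi * t : ℝ) : ℂ) ^ 2 = (μ + w) * (μ - w) := by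
      simp only [hw]; linear_combination ((((2 * Real.pi * t : ℝ) : ℂ)) ^ 2) * Complex.I_sq
    rw [this, neg_div_neg_eq]
    simp only [Complex.ofReal_zero, mul_zero, Complex.exp_zero]
    field_simp
    ring
  · exact (IntegrableOn.congr_fun (hI'.div_const _) e2.symm measurableSet_Iic)
  · exact (IntegrableOn.congr_fun (hI.div_const _) e1.symm measurableSet_Ioi)

/-- Any isometry from ℝ × ℂ can be corrected by the reflection exchanging ‖ξ‖ times the image of the
first axis with ξ. This also covers ξ = 0. -/
theorem exists_isometry_axis (ξ : E3) :
    ∃ e : WithLp 2 (ℝ × ℂ) ≃ₗᵢ[ℝ] E3, ∀ (a : ℝ) (y : ℂ), inner ℝ (e (WithLp.toLp 2 (a, y))) ξ = a * ‖ξ‖ := by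
  have hf : Module.finrank ℝ (WithLp 2 (ℝ × ℂ)) = Module.finrank ℝ E3 := by
    rw [(WithLp.linearEquiv 2 ℝ (ℝ × ℂ)).finrank_eq]
    simp [Complex.finrank_real_complex]
  have hf' : Module.finrank ℝ (WithLp 2 (ℝ × ℂ)) = 3 := by simpa using hf
  let e0 : WithLp 2 (ℝ × ℂ) ≃ₗᵢ[ℝ] E3 :=
    ((stdOrthonormalBasis ℝ (WithLp 2 (ℝ × ℂ))).reindex (finCongr hf')).repr
  set u : WithLp 2 (ℝ × ℂ) := WithLp.toLp 2 (1, 0) with hu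
  have hun : ‖u‖ = 1 := by simp [hu]
  have hnorm : ‖‖ξ‖ • e0 u‖ = ‖ξ‖ := by simp [norm_smul, hun]
  let r := Submodule.reflection (Submodule.span ℝ {‖ξ‖ • e0 u - ξ})ᗮ
  have hr : r (‖ξ‖ • e0 u) = ξ := Submodule.reflection_sub hnorm
  refine ⟨e0.trans r, fun a y => ?_⟩
  conv_lhs => rw [← hr]
  simp only [LinearIsometryEquiv.trans_apply, LinearIsometryEquiv.inner_map_map, inner_smul_right]
  simp [hu, mul_comm]

/-- With the first axis along ξ the phase depends on a alone. Fubini then integrates first over the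
planes orthogonal to ξ and afterwards along the axis; the plane a = 0 is negligible. -/
theorem fourier_yukawa {μ : ℂ} (hμ : 0 < μ.re) (ξ : E3) :
    𝓕 (yukawa μ) ξ = 1 / (μ ^ 2 + (2 * Real.pi * ‖ξ‖ : ℝ) ^ 2) := by
  obtain ⟨e, he⟩ := exists_isometry_axis ξ
  rw [Real.fourier_eq']
  have hint : Integrable (fun v : E3 => Complex.exp (((-2 * Real.pi * inner ℝ v ξ : ℝ) : ℂ) * Complex.I) • yukawa μ v) := by
    have hc : Continuous fun v : E3 =>
        Complex.exp (((-2 * Real.pi * inner ℝ v ξ : ℝ) : ℂ) * Complex.I) := by fun_prop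
    refine (integrable_yukawa hμ).bdd_smul (C := 1) hc.aestronglyMeasurable (.of_forall fun v => ?_)
    rw [Complex.norm_exp_ofReal_mul_I]
  rw [← e.measurePreserving.integral_comp e.toHomeomorph.measurableEmbedding]
  have hint2 := (e.measurePreserving.integrable_comp_emb e.toHomeomorph.measurableEmbedding).2 hint
  have hT := WithLp.volume_preserving_toLp (U := ℝ) (V := ℂ)
  have hTe : MeasurableEmbedding (WithLp.toLp 2 : ℝ × ℂ → WithLp 2 (ℝ × ℂ)) :=
    (MeasurableEquiv.toLp 2 (ℝ × ℂ)).measurableEmbedding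
  rw [← hT.integral_comp hTe]
  have hint3 := (hT.integrable_comp_emb hTe).2 hint2
  rw [Measure.volume_eq_prod, integral_prod _ (by rwa [Measure.volume_eq_prod] at hint3)]
  rw [← integral_exp_neg_abs hμ]
  refine integral_congr_ae ?_
  have : ∀ᵐ a : ℝ, a ≠ 0 := by simp [ae_iff]
  filter_upwards [this] with a ha
  rw [← integral_radial_slice hμ ha, ← integral_const_mul]
  refine integral_congr_ae (.of_forall fun y => ?_)
  simp only [he, smul_eq_mul, yukawa, LinearIsometryEquiv.norm_map, WithLp.prod_norm_eq_of_L2]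
  congr 3
  · push_cast; ring
  · simp

/-! ### The Green function of `Δ² - λ⁴` -/

/-- The symbol `((2π|ξ|)⁴ - z)⁻¹` of `(Δ² - z)⁻¹`. -/
def resolventSymbol (z : ℂ) (ξ : E3) : ℂ := ((((2 * Real.pi * ‖ξ‖) ^ 4 : ℝ) : ℂ) - z)⁻¹

/-- The Green function of `Δ² - λ⁴`. -/
def green (lam : ℂ) (x : E3) : ℂ :=
  (yukawa (-Complex.I * lam) x - yukawa lam x) * (1 / (2 * lam ^ 2))

theorem integrable_green {lam : ℂ} (hre : 0 < lam.re) (him : 0 < lam.im) :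
    Integrable (green lam) :=
  ((integrable_yukawa (by simpa using him)).sub (integrable_yukawa hre)).mul_const _

/-- Partial fractions: 1/(t² - λ²) - 1/(t² + λ²) = 2λ²/(t⁴ - λ⁴) with t = 2π|ξ|. Both denominators
are nonzero since t² is real and Im λ² > 0. -/
theorem fourier_green {lam : ℂ} (hre : 0 < lam.re) (him : 0 < lam.im) (ξ : E3) :
    𝓕 (green lam) ξ = resolventSymbol (lam ^ 4) ξ := by
  have him' : 0 < (-Complex.I * lam).re := by simpa using him
  have h0 : lam ≠ 0 := by rintro rfl; simp at hre
  have e : 𝓕 (green lam) ξ =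
      (𝓕 (yukawa (-Complex.I * lam)) ξ - 𝓕 (yukawa lam) ξ) * (1 / (2 * lam ^ 2)) := by
    simp only [Real.fourier_eq]
    rw [← integral_sub, ← integral_mul_const]
    · refine integral_congr_ae (.of_forall fun v => ?_)
      simp only [green, Circle.smul_def, smul_eq_mul]
      ring
    · exact (Real.fourierIntegral_convergent_iff ξ).2 (integrable_yukawa him')
    · exact (Real.fourierIntegral_convergent_iff ξ).2 (integrable_yukawa hre)
  rw [e, fourier_yukawa him', fourier_yukawa hre, resolventSymbol]
  set t : ℝ := 2 * Real.pi * ‖ξ‖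
  have hsq : (lam ^ 2).im ≠ 0 := by
    simp only [pow_two, Complex.mul_im]
    nlinarith [mul_pos hre him]
  have n1 : (t : ℂ) ^ 2 - lam ^ 2 ≠ 0 := fun h => hsq (by
    have := congrArg Complex.im h
    simpa [← Complex.ofReal_pow] using this)
  have n2 : lam ^ 2 + (t : ℂ) ^ 2 ≠ 0 := fun h => hsq (by
    have := congrArg Complex.im h
    simpa [← Complex.ofReal_pow] using this)
  have n3 : ((t ^ 4 : ℝ) : ℂ) - lam ^ 4 = ((t : ℂ) ^ 2 - lam ^ 2) * (lam ^ 2 + (t : ℂ) ^ 2) := by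
    push_cast; ring
  have n4 : (-Complex.I * lam) ^ 2 + (t : ℂ) ^ 2 = (t : ℂ) ^ 2 - lam ^ 2 := by
    linear_combination lam ^ 2 * Complex.I_sq
  rw [n3, n4]
  field_simp
  ring

/-- The derivative of exp has modulus at most 1 on the left half-plane, which is convex. -/
theorem norm_exp_sub_exp_le {a b : ℂ} (ha : a.re ≤ 0) (hb : b.re ≤ 0) :
    ‖Complex.exp a - Complex.exp b‖ ≤ ‖a - b‖ := by
  have := (convex_halfSpace_re_le (0 : ℝ)).norm_image_sub_le_of_norm_deriv_le (𝕜 := ℂ) (C := 1)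
    (f := Complex.exp) (fun x _ => Complex.differentiableAt_exp)
    (fun x hx => by
      rw [Complex.deriv_exp, Complex.norm_exp]
      exact Real.exp_le_one_iff.2 hx) hb ha
  simpa using this

/-- The difference of the exponentials is at most |1 + i||λ|r ≤ 2|λ|r, which cancels 1/r. The bound
involves only |λ|, so it survives as Im λ → 0, where the integral of |`green lam`| is out of
control. -/
theorem norm_green_le {lam : ℂ} (hre : 0 < lam.re) (him : 0 < lam.im) (x : E3) :
    ‖green lam x‖ ≤ 1 / (4 * Real.pi * ‖lam‖) := by
  have h0 : 0 < ‖lam‖ := norm_pos_iff.2 (by rintro rfl; simp at hre)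
  have hpi := Real.pi_pos
  -- At the origin division by zero gives the Green function the value 0.
  by_cases hx : ‖x‖ = 0
  · simp [green, yukawa, yukawaProfile, hx]
    positivity
  have hr : 0 < ‖x‖ := lt_of_le_of_ne (norm_nonneg _) (Ne.symm hx)
  have e : green lam x = (Complex.exp (-(-Complex.I * lam) * ‖x‖) - Complex.exp (-lam * ‖x‖)) *
      (1 / (8 * Real.pi * ‖x‖ * lam ^ 2)) := by
    simp only [green, yukawa, yukawaProfile]
    field_simp
    ring
  have hb := norm_exp_sub_exp_le (a := -(-Complex.I * lam) * ‖x‖) (b := -lam * ‖x‖)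
    (by simp; positivity) (by simp; positivity)
  have hb2 : ‖-(-Complex.I * lam) * (‖x‖ : ℂ) - -lam * ‖x‖‖ ≤ 2 * ‖lam‖ * ‖x‖ := by
    have : -(-Complex.I * lam) * (‖x‖ : ℂ) - -lam * ‖x‖ = (Complex.I + 1) * (lam * ‖x‖) := by ring
    rw [this, norm_mul, norm_mul, Complex.norm_real, norm_norm, mul_assoc]
    gcongr
    refine (norm_add_le _ _).trans ?_
    simp; norm_num
  rw [e, norm_mul]
  calc _ ≤ (2 * ‖lam‖ * ‖x‖) * ‖1 / (8 * Real.pi * ‖x‖ * lam ^ 2)‖ := by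
        gcongr; exact hb.trans hb2
    _ = _ := by
        simp only [norm_div, norm_mul, norm_one, Complex.norm_real, Real.norm_eq_abs,
          abs_of_pos hpi, norm_pow]
        norm_num
        field_simp
        norm_num

/-! ### Products of Fourier transforms -/

theorem continuous_fourier {f : E3 → ℂ} (hf : Integrable f) : Continuous (𝓕 f) :=
  VectorFourier.fourierIntegral_continuous Real.continuous_fourierChar continuous_inner hf

theorem norm_fourier_le (f : E3 → ℂ) (v : E3) : ‖𝓕 f v‖ ≤ ∫ x, ‖f x‖ :=
  VectorFourier.norm_fourierIntegral_le_integral_norm _ _ _ _ _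

theorem integrable_mul_fourier {U f : E3 → ℂ} (hU : Integrable U) (hf : Integrable f) :
    Integrable fun ξ => U ξ * 𝓕 f ξ :=
  hU.mul_bdd (c := ∫ x, ‖f x‖) (continuous_fourier hf).aestronglyMeasurable (.of_forall (norm_fourier_le f))

/-- The convolution theorem without Fourier inversion: the duality ∫ 𝓕f · g = ∫ f · 𝓕g is applied to
U modulated by the character of v. -/
theorem fourier_mul_fourier {U f : E3 → ℂ} (hU : Integrable U) (hf : Integrable f) (v : E3) :
    𝓕 (fun ξ => U ξ * 𝓕 f ξ) v = ∫ y, f y * 𝓕 U (y + v) := by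
  have hV : Integrable fun ξ => 𝐞 (-inner ℝ ξ v) • U ξ :=
    (Real.fourierIntegral_convergent_iff v).2 hU
  have key := VectorFourier.integral_fourierIntegral_smul_eq_flip (L := innerₗ E3)
    Real.continuous_fourierChar continuous_inner hf hV
  rw [flip_innerₗ] at key
  rw [Real.fourier_eq]
  calc _ = ∫ ξ, 𝓕 f ξ • (𝐞 (-inner ℝ ξ v) • U ξ) := by
        refine integral_congr_ae (.of_forall fun ξ => ?_)
        simp only [Circle.smul_def, smul_eq_mul]; ring
    _ = ∫ y, f y • 𝓕 (fun ξ => 𝐞 (-inner ℝ ξ v) • U ξ) y := key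
    _ = _ := by
        refine integral_congr_ae (.of_forall fun y => ?_)
        simp only [smul_eq_mul, Real.fourier_eq]
        congr 2 with ξ
        rw [smul_smul, ← AddChar.map_add_eq_mul, inner_add_right, neg_add]

theorem norm_fourier_mul_fourier_le {U f : E3 → ℂ} (hU : Integrable U) (hf : Integrable f)
    {B : ℝ} (hB : ∀ v, ‖𝓕 U v‖ ≤ B) (v : E3) :
    ‖𝓕 (fun ξ => U ξ * 𝓕 f ξ) v‖ ≤ B * ∫ x, ‖f x‖ := by
  rw [fourier_mul_fourier hU hf, mul_comm, ← integral_mul_const]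
  refine norm_integral_le_of_norm_le (hf.norm.mul_const B) (.of_forall fun y => ?_)
  rw [norm_mul]
  gcongr
  exact hB _

/-- Here the supremum is taken on G and the L¹ norm on 𝓕p, so the L¹ norm of G never enters. -/
theorem norm_fourier_mul_fourier_le_of_bdd {p G : E3 → ℂ} (hp : Integrable p)
    (hp' : Integrable (𝓕 p)) (hG : Integrable G) {B : ℝ} (hB : ∀ x, ‖G x‖ ≤ B) (v : E3) :
    ‖𝓕 (fun ξ => p ξ * 𝓕 G ξ) v‖ ≤ B * ∫ x, ‖𝓕 p x‖ := by
  rw [fourier_mul_fourier hp hG, ← integral_add_right_eq_self (fun x => ‖𝓕 p x‖) v, ← integral_const_mul]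
  refine norm_integral_le_of_norm_le ((hp'.norm.comp_add_right v).const_mul B) (.of_forall fun y => ?_)
  rw [norm_mul]
  gcongr
  exact hB _

/-- The integral is the value at 0 of a Fourier transform; f and h are peeled off one after the
other at the cost of their L¹ norms. -/
theorem norm_integral_mul_fourier_fourier_le {p G f h : E3 → ℂ} (hp : Integrable p)
    (hp' : Integrable (𝓕 p)) (hG : Integrable G) {B : ℝ} (hB : ∀ x, ‖G x‖ ≤ B)
    (hf : Integrable f) (hh : Integrable h) :
    ‖∫ ξ, p ξ * 𝓕 G ξ * 𝓕 f ξ * 𝓕 h ξ‖ ≤ B * (∫ x, ‖𝓕 p x‖) * (∫ x, ‖f x‖) * ∫ x, ‖h x‖ := by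
  have h1 := integrable_mul_fourier hp hG
  have h2 := integrable_mul_fourier h1 hf
  have := norm_fourier_mul_fourier_le h2 hh
    (norm_fourier_mul_fourier_le h1 hf (norm_fourier_mul_fourier_le_of_bdd hp hp' hG hB)) 0
  simpa [Real.fourier_eq] using this

theorem conj_fourier (h : E3 → ℂ) (ξ : E3) :
    conj (𝓕 h ξ) = 𝓕 (fun x => conj (h (-x))) ξ := by
  simp only [Real.fourier_eq]
  rw [← integral_conj, ← integral_neg_eq_self]
  refine integral_congr_ae (.of_forall fun x => ?_)
  have h2 : conj (2 : ℂ) = 2 := Complex.conj_ofNat 2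
  simp [Circle.smul_def, Real.fourierChar_apply, ← Complex.exp_conj, h2]

/-- The Plancherel transform agrees with the Fourier integral on `L¹ ∩ L²`. -/
theorem coeFn_fourier_L2 (f : L2) (hf : Integrable f) :
    (𝓕 f : L2) =ᵐ[volume] 𝓕 (f : E3 → ℂ) := by
  refine ae_eq_of_integral_contDiff_smul_eq ((Lp.memLp _).locallyIntegrable (by norm_num))
    (continuous_fourier hf).locallyIntegrable fun g hg hgc => ?_
  have hg₁ : HasCompactSupport (Complex.ofRealCLM ∘ g) := hgc.comp_left rfl
  have hg₂ : ContDiff ℝ ∞ (Complex.ofRealCLM ∘ g) := by fun_prop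
  set φ : 𝓢(E3, ℂ) := hg₁.toSchwartzMap hg₂ with hφ
  have hφx : ∀ x, φ x = (g x : ℂ) := fun x => by simp [hφ]
  have e1 : ((𝓕 f : L2) : 𝓢'(E3, ℂ)) φ = (f : 𝓢'(E3, ℂ)) (𝓕 φ) := by
    rw [← Lp.fourier_toTemperedDistribution_eq]; rfl
  simp only [Lp.toTemperedDistribution_apply] at e1
  have key := VectorFourier.integral_fourierIntegral_smul_eq_flip (L := innerₗ E3)
    Real.continuous_fourierChar continuous_inner (φ.integrable (μ := volume)) hf
  rw [flip_innerₗ] at key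
  calc _ = ∫ x, φ x • (𝓕 f : L2) x := by simp [hφx]
    _ = ∫ x, (𝓕 φ) x • f x := e1
    _ = ∫ x, φ x • 𝓕 (f : E3 → ℂ) x := key
    _ = _ := by simp [hφx]

/-! ### Multiplication operators and Fourier multipliers on `L²` -/

open Classical in
/-- Multiplication by an essentially bounded function on `L²(ℝ³)` (`0` if it is not one). -/
def mulOp (a : E3 → ℂ) : L2 →L[ℂ] L2 :=
  if h : MemLp a ⊤ (volume : Measure E3) then
    (ContinuousLinearMap.mul ℂ ℂ).holderL volume ⊤ 2 2 (h.toLp a) else 0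

theorem coeFn_mulOp {a : E3 → ℂ} (ha : MemLp a ⊤ (volume : Measure E3)) (f : L2) :
    mulOp a f =ᵐ[volume] fun x => a x * f x := by
  have h1 := (ContinuousLinearMap.mul ℂ ℂ).coeFn_holder (r := 2) (ha.toLp a) f
  rw [mulOp, dif_pos ha]
  filter_upwards [h1, ha.coeFn_toLp] with x hx hx'
  rw [← hx']
  exact hx

/-- The Fourier multiplier with symbol `a` on `L²(ℝ³)`. -/
def multiplier (a : E3 → ℂ) : L2 →L[ℂ] L2 :=
  ((Lp.fourierTransformₗᵢ E3 ℂ).symm : L2 →L[ℂ] L2) ∘L mulOp a ∘L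
    ((Lp.fourierTransformₗᵢ E3 ℂ) : L2 →L[ℂ] L2)

theorem fourier_multiplier (a : E3 → ℂ) (f : L2) : 𝓕 (multiplier a f) = mulOp a (𝓕 f) :=
  (Lp.fourierTransformₗᵢ E3 ℂ).apply_symm_apply _

theorem coeFn_fourier_multiplier {a : E3 → ℂ} (ha : MemLp a ⊤ (volume : Measure E3)) (f : L2) :
    (𝓕 (multiplier a f) : L2) =ᵐ[volume] fun ξ => a ξ * (𝓕 f : L2) ξ := by
  rw [fourier_multiplier]
  exact coeFn_mulOp ha _

theorem norm_mulOp_apply_le {a : E3 → ℂ} (ha : MemLp a ⊤ (volume : Measure E3)) {C : ℝ}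
    (hC : ∀ x, ‖a x‖ ≤ C) (f : L2) : ‖mulOp a f‖ ≤ C * ‖f‖ := by
  refine Lp.norm_le_mul_norm_of_ae_le_mul ?_
  filter_upwards [coeFn_mulOp ha f] with x hx
  rw [hx, norm_mul]
  gcongr
  exact hC x

theorem norm_multiplier_apply_le {a : E3 → ℂ} (ha : MemLp a ⊤ (volume : Measure E3)) {C : ℝ}
    (hC : ∀ x, ‖a x‖ ≤ C) (f : L2) : ‖multiplier a f‖ ≤ C * ‖f‖ := by
  rw [← Lp.norm_fourier_eq, fourier_multiplier, ← Lp.norm_fourier_eq f]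
  exact norm_mulOp_apply_le ha hC _

theorem fourier_L2_injective {f g : L2} (h : (𝓕 f : L2) =ᵐ[volume] (𝓕 g : L2)) : f = g :=
  (Lp.fourierTransformₗᵢ E3 ℂ).injective (Lp.ext h)

/-- By Plancherel the pairing becomes the previous trilinear integral, with h replaced by its
reflected conjugate. In effect the operator has a kernel bounded by B‖𝓕p‖₁. -/
theorem norm_inner_multiplier_le {p G : E3 → ℂ} (hp : Integrable p)
    (hp' : Integrable (𝓕 p)) (hG : Integrable G) {B : ℝ} (hB : ∀ x, ‖G x‖ ≤ B)
    (ha : MemLp (fun ξ => p ξ * 𝓕 G ξ) ⊤ (volume : Measure E3))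
    (f h : L2) (hf : Integrable f) (hh : Integrable h) :
    ‖inner ℂ h (multiplier (fun ξ => p ξ * 𝓕 G ξ) f)‖ ≤
      B * (∫ x, ‖𝓕 p x‖) * (∫ x, ‖f x‖) * ∫ x, ‖h x‖ := by
  have hh' : Integrable (fun x => conj (h (-x))) :=
    (Complex.conjLIE.integrable_comp_iff (φ := fun x => h (-x))).2 hh.comp_neg
  have e : ∫ x, ‖conj (h (-x))‖ = ∫ x, ‖h x‖ := by
    simp only [RCLike.norm_conj]
    exact integral_neg_eq_self (fun x => ‖h x‖) volume
  rw [← Lp.inner_fourier_eq, L2.inner_def, ← e]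
  convert! norm_integral_mul_fourier_fourier_le hp hp' hG hB hf hh' using 2
  refine integral_congr_ae ?_
  filter_upwards [coeFn_fourier_multiplier ha f, coeFn_fourier_L2 f hf, coeFn_fourier_L2 h hh]
    with ξ h1 h2 h3
  rw [h1, h2, h3, RCLike.inner_apply, conj_fourier]

/-! ### Differential operators on `L²` through the Plancherel transform -/

theorem smulLeftCLM_eq_of_ae {p : E3 → ℂ} (hp : p.HasTemperateGrowth) {u v : L2}
    (h : v =ᵐ[volume] fun x => p x * u x) :
    TemperedDistribution.smulLeftCLM ℂ p (u : 𝓢'(E3, ℂ)) = (v : 𝓢'(E3, ℂ)) := by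
  ext φ
  simp only [TemperedDistribution.smulLeftCLM_apply_apply, Lp.toTemperedDistribution_apply]
  refine integral_congr_ae ?_
  filter_upwards [h] with x hx
  rw [hx, SchwartzMap.smulLeftCLM_apply_apply hp]
  simp only [smul_eq_mul]; ring

/-- Both sides are locally integrable, so testing against smooth compactly supported functions,
which are Schwartz, determines them almost everywhere. -/
theorem ae_eq_of_smulLeftCLM_eq {p : E3 → ℂ} (hp : p.HasTemperateGrowth) {u v : L2}
    (h : TemperedDistribution.smulLeftCLM ℂ p (u : 𝓢'(E3, ℂ)) = (v : 𝓢'(E3, ℂ))) :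
    v =ᵐ[volume] fun x => p x * u x := by
  have hu : LocallyIntegrable (u : E3 → ℂ) := (Lp.memLp u).locallyIntegrable (by norm_num)
  have hpc : Continuous p := hp.1.continuous
  refine ae_eq_of_integral_contDiff_smul_eq ((Lp.memLp v).locallyIntegrable (by norm_num))
    ?_ fun g hg hgc => ?_
  · exact hu.continuous_mul hpc
  have hg₁ : HasCompactSupport (Complex.ofRealCLM ∘ g) := hgc.comp_left rfl
  have hg₂ : ContDiff ℝ ∞ (Complex.ofRealCLM ∘ g) := by fun_prop
  set φ : 𝓢(E3, ℂ) := hg₁.toSchwartzMap hg₂ with hφ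
  have hφx : ∀ x, φ x = (g x : ℂ) := fun x => by simp [hφ]
  have e := congrArg (fun T : 𝓢'(E3, ℂ) => T φ) h
  simp only [TemperedDistribution.smulLeftCLM_apply_apply, Lp.toTemperedDistribution_apply,
    SchwartzMap.smulLeftCLM_apply_apply hp, hφx] at e
  simp only [Complex.real_smul]
  refine Eq.trans ?_ (e.symm.trans ?_)
  · simp
  · simp only [smul_eq_mul]
    exact integral_congr_ae (.of_forall fun x => by ring)

theorem smulLeftCLM_eq_iff {p : E3 → ℂ} (hp : p.HasTemperateGrowth) {u v : L2} :
    TemperedDistribution.smulLeftCLM ℂ p (u : 𝓢'(E3, ℂ)) = (v : 𝓢'(E3, ℂ)) ↔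
      v =ᵐ[volume] fun x => p x * u x :=
  ⟨ae_eq_of_smulLeftCLM_eq hp, smulLeftCLM_eq_of_ae hp⟩

theorem fourier_distribution_injective {S T : 𝓢'(E3, ℂ)} : 𝓕 S = 𝓕 T ↔ S = T := by
  refine ⟨fun h => ?_, fun h => by rw [h]⟩
  have := congrArg (fun X : 𝓢'(E3, ℂ) => (𝓕⁻ X : 𝓢'(E3, ℂ))) h
  simpa using this

theorem fourier_bilaplacian (T : 𝓢'(E3, ℂ)) :
    𝓕 (Δ (Δ T)) = TemperedDistribution.smulLeftCLM ℂ
      (fun ξ : E3 => (((2 * Real.pi * ‖ξ‖) ^ 4 : ℝ) : ℂ)) (𝓕 T) := by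
  have h2 : (fun x : E3 => Complex.ofReal (‖x‖ ^ 2)).HasTemperateGrowth := by fun_prop
  have h4 : ((fun x : E3 => Complex.ofReal (‖x‖ ^ 2)) * fun x : E3 => Complex.ofReal (‖x‖ ^ 2)).HasTemperateGrowth :=
    h2.mul h2
  have e : (fun ξ : E3 => (((2 * Real.pi * ‖ξ‖) ^ 4 : ℝ) : ℂ)) = ((2 * Real.pi) ^ 4 : ℂ) •
      ((fun x : E3 => Complex.ofReal (‖x‖ ^ 2)) * fun x : E3 => Complex.ofReal (‖x‖ ^ 2)) := by
    ext ξ; simp; ring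
  have lap : ∀ S : 𝓢'(E3, ℂ), Δ S = ((-(2 * Real.pi) ^ 2 : ℝ) : ℂ) •
      TemperedDistribution.fourierMultiplierCLM ℂ (fun x : E3 => Complex.ofReal (‖x‖ ^ 2)) S := by
    intro S
    rw [TemperedDistribution.laplacian_eq_fourierMultiplierCLM]
    ext φ
    simp
  rw [e, TemperedDistribution.smulLeftCLM_smul h4, lap (Δ T), lap T, map_smul,
    TemperedDistribution.fourierMultiplierCLM_fourierMultiplierCLM_apply h2 h2, smul_smul,
    FourierTransform.fourier_smul, TemperedDistribution.fourierMultiplierCLM_apply,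
    FourierTransform.fourier_fourierInv_eq, smul_apply]
  congr 1
  push_cast
  ring

theorem hasTemperateGrowth_bilaplacian_symbol :
    (fun ξ : E3 => (((2 * Real.pi * ‖ξ‖) ^ 4 : ℝ) : ℂ)).HasTemperateGrowth := by
  have : (fun ξ : E3 => (((2 * Real.pi) ^ 4 * (‖ξ‖ ^ 2 * ‖ξ‖ ^ 2) : ℝ) : ℂ)).HasTemperateGrowth := by
    fun_prop
  convert! this using 3
  ring

theorem bilaplacian_eq_iff (u w : L2) :
    Δ (Δ (u : 𝓢'(E3, ℂ))) = (w : 𝓢'(E3, ℂ)) ↔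
      (𝓕 w : L2) =ᵐ[volume] fun ξ => (((2 * Real.pi * ‖ξ‖) ^ 4 : ℝ) : ℂ) * (𝓕 u : L2) ξ := by
  rw [← fourier_distribution_injective, fourier_bilaplacian, Lp.fourier_toTemperedDistribution_eq,
    Lp.fourier_toTemperedDistribution_eq, smulLeftCLM_eq_iff hasTemperateGrowth_bilaplacian_symbol]

theorem lineDeriv_eq_of_ae {u v : L2} (i : Fin 3)
    (h : (𝓕 v : L2) =ᵐ[volume] fun ξ => (2 * Real.pi * Complex.I * (ξ i : ℂ)) * (𝓕 u : L2) ξ) :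
    ∂_{(EuclideanSpace.single i (1 : ℝ) : E3)} (u : 𝓢'(E3, ℂ)) = (v : 𝓢'(E3, ℂ)) := by
  have h1 : (fun ξ : E3 => ((inner ℝ ξ (EuclideanSpace.single i (1 : ℝ)) : ℝ) : ℂ)).HasTemperateGrowth := by
    fun_prop
  rw [← fourier_distribution_injective, TemperedDistribution.fourier_lineDerivOp_eq]
  rw [Lp.fourier_toTemperedDistribution_eq,
    Lp.fourier_toTemperedDistribution_eq, ← smul_apply, ← TemperedDistribution.smulLeftCLM_smul h1]
  refine smulLeftCLM_eq_of_ae ?_ ?_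
  · have := (Function.HasTemperateGrowth.const (E := E3) (2 * Real.pi * Complex.I)).mul h1
    exact this
  · filter_upwards [h] with ξ hξ
    have e : inner ℝ ξ (EuclideanSpace.single i (1 : ℝ)) = ξ i := by
      simp [EuclideanSpace.inner_single_right]
    rw [hξ]
    simp [e]

/-! ### The resolvent as a Fourier multiplier -/

theorem measurable_resolventSymbol (z : ℂ) : Measurable (resolventSymbol z) := by
  unfold resolventSymbol
  fun_prop

/-- The symbol `∏ (2πi ξ_j)` of the iterated partial derivative `∂_{l₁} ⋯ ∂_{lₙ}`. -/
def derivSymbol (l : List (Fin 3)) (ξ : E3) : ℂ :=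
  (l.map fun i => 2 * Real.pi * Complex.I * (ξ i : ℂ)).prod

@[simp] theorem derivSymbol_nil (ξ : E3) : derivSymbol [] ξ = 1 := rfl

theorem derivSymbol_cons (i : Fin 3) (l : List (Fin 3)) (ξ : E3) :
    derivSymbol (i :: l) ξ = 2 * Real.pi * Complex.I * (ξ i : ℂ) * derivSymbol l ξ := by
  simp [derivSymbol]

theorem contDiff_derivSymbol (l : List (Fin 3)) : ContDiff ℝ ∞ (derivSymbol l) := by
  induction l with
  | nil => exact contDiff_const
  | cons i l ih =>
    have h1 : ContDiff ℝ ∞ fun ξ : E3 => (2 * Real.pi * Complex.I * (ξ i : ℂ) : ℂ) :=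
      contDiff_const.mul (Complex.ofRealCLM.contDiff.comp (EuclideanSpace.proj (𝕜 := ℝ) i).contDiff)
    exact (funext (derivSymbol_cons i l) : derivSymbol (i :: l) = _) ▸ h1.mul ih

theorem norm_derivSymbol_le (l : List (Fin 3)) (ξ : E3) :
    ‖derivSymbol l ξ‖ ≤ (2 * Real.pi * ‖ξ‖) ^ l.length := by
  induction l with
  | nil => simp
  | cons i l ih =>
    rw [derivSymbol_cons, norm_mul, List.length_cons, pow_succ']
    have : ‖2 * Real.pi * Complex.I * (ξ i : ℂ)‖ ≤ 2 * Real.pi * ‖ξ‖ := by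
      have := PiLp.norm_apply_le ξ i
      simp [abs_of_pos Real.pi_pos] at this ⊢
      gcongr
    gcongr

theorem pow_le_one_add_pow_four {t : ℝ} (ht : 0 ≤ t) {n : ℕ} (hn : n ≤ 4) : t ^ n ≤ 1 + t ^ 4 := by
  rcases le_total t 1 with h | h
  · have := pow_le_one₀ (n := n) ht h
    have := pow_nonneg ht 4
    linarith
  · have := pow_le_pow_right₀ h hn
    linarith

/-- Combine t ≤ |t - z| + |z| with c ≤ |t - z|. The bound blows up as c → 0 and serves only to make
the multipliers well defined up to order 4. -/
theorem norm_resolventSymbol_mul_le {z : ℂ} {c : ℝ} (hc : 0 < c)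
    (hz : ∀ t : ℝ, 0 ≤ t → c ≤ ‖(t : ℂ) - z‖) (ξ : E3) :
    (1 + (2 * Real.pi * ‖ξ‖) ^ 4) * ‖resolventSymbol z ξ‖ ≤ (1 + ‖z‖) / c + 1 := by
  set t : ℝ := (2 * Real.pi * ‖ξ‖) ^ 4 with ht
  have ht0 : 0 ≤ t := by positivity
  have h1 := hz t ht0
  have h2 : t ≤ ‖(t : ℂ) - z‖ + ‖z‖ := by
    have := norm_add_le ((t : ℂ) - z) z
    rw [sub_add_cancel, Complex.norm_real, Real.norm_of_nonneg ht0] at this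
    exact this
  have h3 : 0 < ‖(t : ℂ) - z‖ := hc.trans_le h1
  rw [resolventSymbol, norm_inv, ← ht, ← div_eq_mul_inv, div_le_iff₀ h3]
  have h4 : (1 + ‖z‖) ≤ (1 + ‖z‖) / c * ‖(t : ℂ) - z‖ := by
    rw [div_mul_eq_mul_div, le_div_iff₀ hc]
    gcongr
  linarith

theorem memLp_deriv_mul_resolventSymbol {z : ℂ} {c : ℝ} (hc : 0 < c)
    (hz : ∀ t : ℝ, 0 ≤ t → c ≤ ‖(t : ℂ) - z‖) {l : List (Fin 3)} (hl : l.length ≤ 4) :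
    MemLp (fun ξ => derivSymbol l ξ * resolventSymbol z ξ) ⊤ (volume : Measure E3) := by
  refine memLp_top_of_bound
    ((contDiff_derivSymbol l).continuous.measurable.mul (measurable_resolventSymbol z)).aestronglyMeasurable
    ((1 + ‖z‖) / c + 1) (.of_forall fun ξ => ?_)
  refine le_trans ?_ (norm_resolventSymbol_mul_le hc hz ξ)
  rw [norm_mul]
  gcongr
  exact (norm_derivSymbol_le l ξ).trans (pow_le_one_add_pow_four (by positivity) hl)

/-- The operator `∂_{l₁} ⋯ ∂_{lₙ} (Δ² - z)⁻¹` on `L²(ℝ³)`. -/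
def derivResolvent (l : List (Fin 3)) (z : ℂ) : L2 →L[ℂ] L2 :=
  multiplier fun ξ => derivSymbol l ξ * resolventSymbol z ξ

theorem coeFn_fourier_derivResolvent {z : ℂ} {c : ℝ} (hc : 0 < c)
    (hz : ∀ t : ℝ, 0 ≤ t → c ≤ ‖(t : ℂ) - z‖) {l : List (Fin 3)} (hl : l.length ≤ 4) (f : L2) :
    (𝓕 (derivResolvent l z f) : L2) =ᵐ[volume]
      fun ξ => derivSymbol l ξ * resolventSymbol z ξ * (𝓕 f : L2) ξ :=
  coeFn_fourier_multiplier (memLp_deriv_mul_resolventSymbol hc hz hl) f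

theorem lineDeriv_derivResolvent {z : ℂ} {c : ℝ} (hc : 0 < c)
    (hz : ∀ t : ℝ, 0 ≤ t → c ≤ ‖(t : ℂ) - z‖) {l : List (Fin 3)} (i : Fin 3) (hl : l.length < 4)
    (f : L2) :
    ∂_{(EuclideanSpace.single i (1 : ℝ) : E3)} (derivResolvent l z f : 𝓢'(E3, ℂ)) =
      (derivResolvent (i :: l) z f : 𝓢'(E3, ℂ)) := by
  refine lineDeriv_eq_of_ae i ?_
  filter_upwards [coeFn_fourier_derivResolvent hc hz hl.le f,
    coeFn_fourier_derivResolvent hc hz (l := i :: l) hl f] with ξ h1 h2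
  rw [h1, h2, derivSymbol_cons]
  ring

theorem sub_mul_resolventSymbol {z : ℂ} {c : ℝ} (hc : 0 < c)
    (hz : ∀ t : ℝ, 0 ≤ t → c ≤ ‖(t : ℂ) - z‖) (ξ : E3) :
    ((((2 * Real.pi * ‖ξ‖) ^ 4 : ℝ) : ℂ) - z) * resolventSymbol z ξ = 1 := by
  refine mul_inv_cancel₀ fun h => ?_
  have := hz ((2 * Real.pi * ‖ξ‖) ^ 4) (by positivity)
  rw [h, norm_zero] at this
  linarith

theorem coe_add_smul (f u : L2) (z : ℂ) :
    ((f + z • u : L2) : 𝓢'(E3, ℂ)) = (f : 𝓢'(E3, ℂ)) + z • (u : 𝓢'(E3, ℂ)) := by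
  simp only [← Lp.toTemperedDistributionCLM_apply, map_add, map_smul]

theorem coeFn_fourier_add_smul (f u : L2) (z : ℂ) :
    (𝓕 (f + z • u) : L2) =ᵐ[volume] fun ξ => (𝓕 f : L2) ξ + z * (𝓕 u : L2) ξ := by
  rw [FourierTransform.fourier_add, FourierTransform.fourier_smul]
  filter_upwards [Lp.coeFn_add (𝓕 f : L2) (z • 𝓕 u), Lp.coeFn_smul z (𝓕 u : L2)] with ξ h1 h2
  rw [h1, Pi.add_apply, h2, Pi.smul_apply, smul_eq_mul]

theorem bilaplacian_sub_smul_eq_iff (u f : L2) (z : ℂ) :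
    Δ (Δ (u : 𝓢'(E3, ℂ))) - z • (u : 𝓢'(E3, ℂ)) = (f : 𝓢'(E3, ℂ)) ↔
      (𝓕 f : L2) =ᵐ[volume] fun ξ => ((((2 * Real.pi * ‖ξ‖) ^ 4 : ℝ) : ℂ) - z) * (𝓕 u : L2) ξ := by
  rw [sub_eq_iff_eq_add, ← coe_add_smul, bilaplacian_eq_iff]
  constructor <;> intro h <;> filter_upwards [h, coeFn_fourier_add_smul f u z] with ξ h1 h2
  · rw [h2] at h1
    linear_combination h1
  · rw [h2, h1]; ring

theorem memSobolev_derivResolvent {z : ℂ} {c : ℝ} (hc : 0 < c)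
    (hz : ∀ t : ℝ, 0 ≤ t → c ≤ ‖(t : ℂ) - z‖) (f : L2) :
    TemperedDistribution.MemSobolev 4 2 (derivResolvent [] z f : 𝓢'(E3, ℂ)) := by
  rw [TemperedDistribution.memSobolev_iff_exists_smulLeftCLM_fourier]
  set a : E3 → ℂ := fun ξ => ((((1 + ‖ξ‖ ^ 2) ^ ((4 : ℝ) / 2) : ℝ) : ℂ)) * resolventSymbol z ξ with hadef
  have hg : (fun x : E3 => (((1 + ‖x‖ ^ 2) ^ ((4 : ℝ) / 2) : ℝ) : ℂ)).HasTemperateGrowth := by fun_prop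
  have ha : MemLp a ⊤ (volume : Measure E3) := by
    refine memLp_top_of_bound
      (hg.1.continuous.measurable.mul (measurable_resolventSymbol z)).aestronglyMeasurable
      (2 * ((1 + ‖z‖) / c + 1)) (.of_forall fun ξ => ?_)
    refine le_trans ?_ (mul_le_mul_of_nonneg_left (norm_resolventSymbol_mul_le hc hz ξ) (by norm_num))
    rw [hadef, norm_mul, ← mul_assoc]
    gcongr
    have h2 : (1 + ‖ξ‖ ^ 2) ^ ((4 : ℝ) / 2) = (1 + ‖ξ‖ ^ 2) ^ 2 := by
      rw [← Real.rpow_natCast]; norm_num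
    rw [Complex.norm_real, Real.norm_of_nonneg (by positivity), h2]
    have h3 : ‖ξ‖ ^ 4 ≤ (2 * Real.pi * ‖ξ‖) ^ 4 := by
      gcongr
      nlinarith [Real.pi_gt_three, norm_nonneg ξ]
    nlinarith [sq_nonneg (1 - ‖ξ‖ ^ 2)]
  refine ⟨mulOp a (𝓕 f), ?_⟩
  rw [Lp.fourier_toTemperedDistribution_eq]
  refine smulLeftCLM_eq_of_ae hg ?_
  filter_upwards [coeFn_mulOp ha (𝓕 f),
    coeFn_fourier_derivResolvent hc hz (l := []) (by simp) f] with ξ h1 h2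
  rw [h1, h2, derivSymbol_nil]
  ring

theorem isResolventAt_derivResolvent {z : ℂ} {c : ℝ} (hc : 0 < c)
    (hz : ∀ t : ℝ, 0 ≤ t → c ≤ ‖(t : ℂ) - z‖) : IsResolventAt z (derivResolvent [] z) where
  mem_domain := memSobolev_derivResolvent hc hz
  right_inv f := by
    rw [bilaplacian_sub_smul_eq_iff]
    filter_upwards [coeFn_fourier_derivResolvent hc hz (l := []) (by simp) f] with ξ h
    rw [h, derivSymbol_nil, one_mul, ← mul_assoc, sub_mul_resolventSymbol hc hz, one_mul]
  left_inv u f _ h := by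
    rw [bilaplacian_sub_smul_eq_iff] at h
    refine fourier_L2_injective ?_
    filter_upwards [h, coeFn_fourier_derivResolvent hc hz (l := []) (by simp) f] with ξ h1 h2
    rw [h2, h1, derivSymbol_nil, one_mul]
    linear_combination (𝓕 u : L2) ξ * sub_mul_resolventSymbol hc hz ξ

theorem IsResolventAt.unique {z : ℂ} {S T : L2 →L[ℂ] L2} (hS : IsResolventAt z S)
    (hT : IsResolventAt z T) : S = T := by
  ext1 f
  exact hS.left_inv _ _ (hT.mem_domain f) (hT.right_inv f)

theorem biharmonicResolvent_eq {z : ℂ} {T : L2 →L[ℂ] L2} (hT : IsResolventAt z T) :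
    biharmonicResolvent z = T := by
  have h : ∃ T : L2 →L[ℂ] L2, IsResolventAt z T := ⟨T, hT⟩
  rw [biharmonicResolvent, dif_pos h]
  exact h.choose_spec.unique hT

/-- The first resolvent identity. -/
theorem derivResolvent_eq_comp {z w : ℂ} {c c' : ℝ} (hc : 0 < c)
    (hz : ∀ t : ℝ, 0 ≤ t → c ≤ ‖(t : ℂ) - z‖) (hc' : 0 < c')
    (hw : ∀ t : ℝ, 0 ≤ t → c' ≤ ‖(t : ℂ) - w‖) {l : List (Fin 3)} (hl : l.length ≤ 4) :
    derivResolvent l z = derivResolvent l w ∘L (1 + (z - w) • derivResolvent [] z) := by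
  ext1 f
  refine fourier_L2_injective ?_
  simp only [ContinuousLinearMap.comp_apply, add_apply, smul_apply, one_apply_eq_self]
  filter_upwards [coeFn_fourier_derivResolvent hc hz hl f,
    coeFn_fourier_derivResolvent hc hz (l := []) (by simp) f,
    coeFn_fourier_derivResolvent hc' hw hl (f + (z - w) • derivResolvent [] z f),
    coeFn_fourier_add_smul f (derivResolvent [] z f) (z - w)] with ξ h1 h2 h3 h4
  rw [h3, h4, h1, h2, derivSymbol_nil]
  have e1 := sub_mul_resolventSymbol hc hz ξ
  have e2 := sub_mul_resolventSymbol hc' hw ξ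
  -- On symbols the identity reads 1/(t - z) = (1/(t - w))(1 + (z - w)/(t - z)).
  linear_combination (-derivSymbol l ξ * resolventSymbol z ξ * (𝓕 f : L2) ξ) * e2 + derivSymbol l ξ * resolventSymbol w ξ * (𝓕 f : L2) ξ * e1

/-! ### Analyticity of the resolvent off the real axis -/

theorem le_norm_sub_of_im_pos {z : ℂ} (t : ℝ) : |z.im| ≤ ‖(t : ℂ) - z‖ := by
  simpa using Complex.abs_im_le_norm ((t : ℂ) - z)

/-- The resolvent identity gives R(w) = R(z)(1 - (z - w)R(w)). For z near w the last factor is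
invertible, and inversion is analytic near 1. -/
theorem analyticAt_derivResolvent {w : ℂ} (hw : w.im ≠ 0) :
    AnalyticAt ℂ (derivResolvent []) w := by
  have e : (fun z => derivResolvent [] w * Ring.inverse (1 - (z - w) • derivResolvent [] w)) =ᶠ[nhds w]
      derivResolvent [] := by
    have h1 : ∀ᶠ z in nhds w, z.im ≠ 0 :=
      Complex.continuous_im.continuousAt.eventually_ne hw
    have h2 : ∀ᶠ z in nhds w, IsUnit (1 - (z - w) • derivResolvent [] w) := by
      have hc : Continuous fun z : ℂ => 1 - (z - w) • derivResolvent [] w := by fun_prop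
      refine hc.continuousAt.eventually (Units.isOpen.mem_nhds ?_)
      simp
    filter_upwards [h1, h2] with z hz hu
    have := derivResolvent_eq_comp (abs_pos.2 hw) (fun t _ => le_norm_sub_of_im_pos t)
      (abs_pos.2 hz) (fun t _ => le_norm_sub_of_im_pos t) (l := []) (by simp)
    have e : derivResolvent [] w = derivResolvent [] z * (1 - (z - w) • derivResolvent [] w) := by
      conv_lhs => rw [this]
      rw [ContinuousLinearMap.mul_def, sub_eq_add_neg 1, ← neg_smul, neg_sub]
    calc _ = derivResolvent [] z * (1 - (z - w) • derivResolvent [] w) *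
          Ring.inverse (1 - (z - w) • derivResolvent [] w) := by rw [← e]
      _ = _ := Ring.mul_inverse_cancel_right _ _ hu
  refine AnalyticAt.congr ?_ e
  refine analyticAt_const.mul ?_
  have h3 : AnalyticAt ℂ (fun z : ℂ => (z - w) • derivResolvent [] w) w :=
    (analyticAt_id.sub analyticAt_const).smul analyticAt_const
  refine AnalyticAt.fun_comp (g := fun x : L2 →L[ℂ] L2 => Ring.inverse (1 - x)) ?_ h3
  simpa using analyticAt_inverse_one_sub ℂ (L2 →L[ℂ] L2)

/-! ### Restriction to a ball and extension by zero -/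

/-- Restriction `L²(ℝ³) → L²(B_R)`. -/
def restrictBall (R : ℝ) : L2 →L[ℂ] L2Ball R :=
  LpToLpRestrictCLM E3 ℂ ℂ volume 2 (ball (0 : E3) R)

theorem coeFn_restrictBall (R : ℝ) (v : L2) :
    restrictBall R v =ᵐ[volume.restrict (ball (0 : E3) R)] v :=
  LpToLpRestrictCLM_coeFn ℂ _ v

theorem norm_restrictBall_apply_le (R : ℝ) (v : L2) : ‖restrictBall R v‖ ≤ ‖v‖ :=
  norm_Lp_toLp_restrict_le _ v

theorem coeFn_extendByZero {R : ℝ} (w : L2Ball R) :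
    extendByZero w =ᵐ[volume] (ball (0 : E3) R).indicator w :=
  MemLp.coeFn_toLp _

/-- Extension by zero is the adjoint of restriction; its linearity, continuity and norm bound are
drawn from this. -/
theorem inner_extendByZero {R : ℝ} (w : L2Ball R) (v : L2) :
    inner ℂ (extendByZero w) v = inner ℂ w (restrictBall R v) := by
  rw [L2.inner_def, L2.inner_def]
  have e : ∀ᵐ x : E3, inner ℂ (extendByZero w x) (v x) =
      (ball (0 : E3) R).indicator (fun x => inner ℂ (w x) (v x)) x := by
    filter_upwards [coeFn_extendByZero w] with x hx
    rw [hx]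
    by_cases h : x ∈ ball (0 : E3) R <;> simp [h, indicator]
  rw [integral_congr_ae e, integral_indicator measurableSet_ball]
  refine integral_congr_ae ?_
  filter_upwards [coeFn_restrictBall R v] with x hx
  rw [hx]

/-- Extension by zero as a continuous linear map. -/
def extendCLM (R : ℝ) : L2Ball R →L[ℂ] L2 := ContinuousLinearMap.adjoint (restrictBall R)

theorem extendCLM_apply {R : ℝ} (w : L2Ball R) : extendCLM R w = extendByZero w := by
  refine ext_inner_right ℂ fun v => ?_
  rw [extendCLM, ContinuousLinearMap.adjoint_inner_left, inner_extendByZero]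

theorem norm_extendByZero_le {R : ℝ} (w : L2Ball R) : ‖extendByZero w‖ ≤ ‖w‖ := by
  have h := inner_extendByZero w (extendByZero w)
  have h1 : ‖extendByZero w‖ * ‖extendByZero w‖ ≤ ‖w‖ * ‖extendByZero w‖ := by
    rw [← inner_self_eq_norm_mul_norm (𝕜 := ℂ), h, RCLike.re_to_complex]
    refine ((Complex.re_le_norm _).trans (norm_inner_le_norm _ _)).trans ?_
    gcongr
    exact norm_restrictBall_apply_le _ _
  rcases (norm_nonneg (extendByZero w)).eq_or_lt with h0 | h0
  · rw [← h0]; exact norm_nonneg _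
  · exact le_of_mul_le_mul_right h1 h0

instance isFiniteMeasure_ball (R : ℝ) :
    IsFiniteMeasure ((volume : Measure E3).restrict (ball (0 : E3) R)) :=
  ⟨by simpa using measure_ball_lt_top (μ := (volume : Measure E3)) (x := (0 : E3)) (r := R)⟩

theorem integrable_extendByZero {R : ℝ} (w : L2Ball R) : Integrable (extendByZero w) := by
  have hw : Integrable w (volume.restrict (ball (0 : E3) R)) := (Lp.memLp w).integrable (by norm_num)
  exact ((integrable_indicator_iff measurableSet_ball).2 hw).congr (coeFn_extendByZero w).symm

/-- Hölder on the ball; the constant is the square root of its volume. -/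
theorem exists_integral_norm_extendByZero_le (R : ℝ) :
    ∃ V : ℝ, 0 ≤ V ∧ ∀ w : L2Ball R, ∫ x, ‖extendByZero w x‖ ≤ V * ‖w‖ := by
  set ν := (volume : Measure E3).restrict (ball (0 : E3) R)
  refine ⟨(ν univ ^ (1 / (1 : ENNReal).toReal - 1 / (2 : ENNReal).toReal)).toReal, ENNReal.toReal_nonneg,
    fun w => ?_⟩
  have e : ∀ᵐ x : E3, ‖extendByZero w x‖ = (ball (0 : E3) R).indicator (fun x => ‖w x‖) x := by
    filter_upwards [coeFn_extendByZero w] with x hx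
    rw [hx, norm_indicator_eq_indicator_norm]
  rw [integral_congr_ae e, integral_indicator measurableSet_ball]
  have h := eLpNorm_le_eLpNorm_mul_rpow_measure_univ (μ := ν) (p := 1) (q := 2) (f := w) (by norm_num)
    (Lp.aestronglyMeasurable w)
  have h2 := ENNReal.toReal_mono (ENNReal.mul_ne_top (Lp.memLp w).2.ne
    (ENNReal.rpow_ne_top_of_nonneg (by norm_num) (measure_ne_top ν univ))) h
  rw [ENNReal.toReal_mul] at h2
  rw [integral_norm_eq_lintegral_enorm (Lp.aestronglyMeasurable w), ← eLpNorm_one_eq_lintegral_enorm,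
    Lp.norm_def, mul_comm]
  exact h2

/-! ### Local bounds for the resolvent, uniform up to the spectrum -/

theorem derivSymbol_smul (l : List (Fin 3)) (c : ℝ) (ξ : E3) :
    derivSymbol l (c • ξ) = (c : ℂ) ^ l.length * derivSymbol l ξ := by
  induction l with
  | nil => simp
  | cons i l ih =>
    rw [derivSymbol_cons, derivSymbol_cons, ih, List.length_cons, pow_succ]
    simp only [PiLp.smul_apply, smul_eq_mul, Complex.ofReal_mul]
    ring

theorem fourier_comp_inv_smul {s : ℝ} (hs : 0 < s) (q : E3 → ℂ) (v : E3) :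
    𝓕 (fun ξ => q (s⁻¹ • ξ)) v = (s ^ 3 : ℝ) • 𝓕 q (s • v) := by
  have h := Measure.integral_comp_inv_smul_of_nonneg (volume : Measure E3)
    (fun η => 𝐞 (-inner ℝ η (s • v)) • q η) hs.le
  rw [finrank_euclideanSpace, Fintype.card_fin] at h
  rw [Real.fourier_eq, Real.fourier_eq, ← h]
  refine integral_congr_ae (.of_forall fun ξ => ?_)
  simp only [inner_smul_left, inner_smul_right]
  congr 3
  simp
  field_simp

/-- The factor s³ in front of the dilated transform is the Jacobian of the dilation, so the L¹ norm
does not see s. -/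
theorem integral_norm_fourier_comp_inv_smul {s : ℝ} (hs : 0 < s) (q : E3 → ℂ) :
    ∫ v, ‖𝓕 (fun ξ => q (s⁻¹ • ξ)) v‖ = ∫ v, ‖𝓕 q v‖ := by
  simp only [fourier_comp_inv_smul hs, norm_smul]
  rw [integral_const_mul, Measure.integral_comp_smul_of_nonneg (volume : Measure E3) (fun v => ‖𝓕 q v‖) s (hR := hs.le),
    finrank_euclideanSpace, Fintype.card_fin, smul_eq_mul, Real.norm_of_nonneg (by positivity)]
  field_simp

/-- A smooth cut-off equal to `1` on the unit ball. -/
def frequencyCutoff : ContDiffBump (0 : E3) := ⟨1, 2, by norm_num, by norm_num⟩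

/-- The low frequency part of `derivSymbol`, as a Schwartz function. -/
def lowSymbol (l : List (Fin 3)) : 𝓢(E3, ℂ) :=
  HasCompactSupport.toSchwartzMap (f := fun ξ => derivSymbol l ξ * (frequencyCutoff ξ : ℂ))
    ((frequencyCutoff.hasCompactSupport.comp_left (g := Complex.ofReal) rfl).mul_left)
    ((contDiff_derivSymbol l).mul (Complex.ofRealCLM.contDiff.comp frequencyCutoff.contDiff))

theorem lowSymbol_apply (l : List (Fin 3)) (ξ : E3) :
    lowSymbol l ξ = derivSymbol l ξ * (frequencyCutoff ξ : ℂ) := rfl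

/-- `derivSymbol`, cut off at frequencies of size `s`. -/
def scaledLowSymbol (l : List (Fin 3)) (s : ℝ) (ξ : E3) : ℂ :=
  derivSymbol l ξ * (frequencyCutoff (s⁻¹ • ξ) : ℂ)

theorem scaledLowSymbol_eq (l : List (Fin 3)) {s : ℝ} (hs : 0 < s) (ξ : E3) :
    scaledLowSymbol l s ξ = (s : ℂ) ^ l.length * lowSymbol l (s⁻¹ • ξ) := by
  rw [scaledLowSymbol, lowSymbol_apply, derivSymbol_smul]
  have : (s : ℂ) ^ l.length ≠ 0 := pow_ne_zero _ (by exact_mod_cast hs.ne')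
  rw [Complex.ofReal_inv, inv_pow, ← mul_assoc, mul_inv_cancel_left₀ this]

theorem integrable_scaledLowSymbol (l : List (Fin 3)) {s : ℝ} (hs : 0 < s) :
    Integrable (scaledLowSymbol l s) := by
  rw [funext (scaledLowSymbol_eq l hs)]
  exact ((lowSymbol l).integrable.comp_smul (inv_ne_zero hs.ne')).const_mul _

theorem fourier_scaledLowSymbol (l : List (Fin 3)) {s : ℝ} (hs : 0 < s) (v : E3) :
    𝓕 (scaledLowSymbol l s) v =
      (s : ℂ) ^ l.length * 𝓕 (fun ξ => lowSymbol l (s⁻¹ • ξ)) v := by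
  rw [funext (scaledLowSymbol_eq l hs), Real.fourier_eq, Real.fourier_eq, ← integral_const_mul]
  refine integral_congr_ae (.of_forall fun ξ => ?_)
  simp only [Circle.smul_def, smul_eq_mul]
  ring

theorem integrable_fourier_scaledLowSymbol (l : List (Fin 3)) {s : ℝ} (hs : 0 < s) :
    Integrable (𝓕 (scaledLowSymbol l s)) := by
  rw [funext (fourier_scaledLowSymbol l hs)]
  refine Integrable.const_mul ?_ _
  rw [funext (fourier_comp_inv_smul hs _)]
  exact ((𝓕 (lowSymbol l)).integrable.comp_smul hs.ne').smul (s ^ 3 : ℝ)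

theorem integral_norm_fourier_scaledLowSymbol (l : List (Fin 3)) {s : ℝ} (hs : 0 < s) :
    ∫ v, ‖𝓕 (scaledLowSymbol l s) v‖ = s ^ l.length * ∫ v, ‖𝓕 (lowSymbol l) v‖ := by
  simp only [fourier_scaledLowSymbol l hs, norm_mul]
  rw [integral_const_mul, integral_norm_fourier_comp_inv_smul hs]
  rw [norm_pow, Complex.norm_real, Real.norm_of_nonneg hs.le]
  rfl

theorem frequencyCutoff_mem (ξ : E3) : 0 ≤ frequencyCutoff ξ ∧ frequencyCutoff ξ ≤ 1 :=
  ⟨frequencyCutoff.nonneg, frequencyCutoff.le_one⟩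

/-- For |ξ| ≤ |λ| the cut-off is 1 and the symbol vanishes. Otherwise t = 2π|ξ| ≥ 2|λ|, hence |t⁴ -
λ⁴| ≥ t⁴/2, and t^{n-4} ≤ |λ|^{n-4} for n ≤ 4. -/
theorem norm_high_symbol_le {l : List (Fin 3)} (hl : l.length ≤ 4) {lam : ℂ} (h0 : 0 < ‖lam‖) (ξ : E3) :
    ‖(derivSymbol l ξ - scaledLowSymbol l ‖lam‖ ξ) * resolventSymbol (lam ^ 4) ξ‖ ≤
      2 * (‖lam‖ ^ l.length / ‖lam‖ ^ 4) := by
  set s := ‖lam‖ with hs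
  have e : derivSymbol l ξ - scaledLowSymbol l s ξ =
      derivSymbol l ξ * ((1 - frequencyCutoff (s⁻¹ • ξ) : ℝ) : ℂ) := by
    rw [scaledLowSymbol]; push_cast; ring
  rw [e]
  rcases le_or_gt ‖ξ‖ s with h | h
  · have : frequencyCutoff (s⁻¹ • ξ) = 1 := by
      refine frequencyCutoff.one_of_mem_closedBall ?_
      rw [mem_closedBall_zero_iff, norm_smul, norm_inv, Real.norm_of_nonneg h0.le]
      change s⁻¹ * ‖ξ‖ ≤ 1
      rw [inv_mul_le_iff₀ h0, mul_one]
      exact h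
    rw [this]
    simp
    positivity
  · obtain ⟨hc0, hc1⟩ := frequencyCutoff_mem (s⁻¹ • ξ)
    set t : ℝ := 2 * Real.pi * ‖ξ‖ with ht
    have hts : 2 * s ≤ t := by nlinarith [Real.pi_gt_three]
    have ht0 : 0 < t := by linarith
    have h4 : (2 * s) ^ 4 ≤ t ^ 4 := by gcongr
    have hden : t ^ 4 / 2 ≤ ‖((t ^ 4 : ℝ) : ℂ) - lam ^ 4‖ := by
      have := norm_sub_norm_le ((t ^ 4 : ℝ) : ℂ) (lam ^ 4)
      rw [Complex.norm_real, Real.norm_of_nonneg (by positivity), norm_pow, ← hs] at this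
      nlinarith [pow_pos h0 4]
    have hsym : ‖resolventSymbol (lam ^ 4) ξ‖ ≤ 2 / t ^ 4 := by
      rw [resolventSymbol, norm_inv, ← inv_div]
      exact inv_anti₀ (by positivity) hden
    have hn : t ^ l.length / t ^ 4 ≤ s ^ l.length / s ^ 4 := by
      rw [div_le_div_iff₀ (by positivity) (by positivity)]
      obtain ⟨m, hm⟩ := Nat.exists_eq_add_of_le hl
      rw [hm, pow_add, pow_add]
      have : s ^ m ≤ t ^ m := by gcongr; linarith
      calc t ^ l.length * (s ^ l.length * s ^ m) ≤ t ^ l.length * (s ^ l.length * t ^ m) := by gcongr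
        _ = _ := by ring
    rw [norm_mul, norm_mul, Complex.norm_real, Real.norm_of_nonneg (by linarith)]
    calc _ ≤ t ^ l.length * 1 * (2 / t ^ 4) := by
          gcongr
          · exact norm_derivSymbol_le l ξ
          · linarith
      _ = 2 * (t ^ l.length / t ^ 4) := by ring
      _ ≤ _ := by gcongr

theorem multiplier_add {a b : E3 → ℂ} (ha : MemLp a ⊤ (volume : Measure E3))
    (hb : MemLp b ⊤ (volume : Measure E3)) (f : L2) :
    multiplier (fun ξ => a ξ + b ξ) f = multiplier a f + multiplier b f := by
  refine fourier_L2_injective ?_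
  rw [FourierTransform.fourier_add]
  filter_upwards [coeFn_fourier_multiplier (ha.add hb) f, coeFn_fourier_multiplier ha f,
    coeFn_fourier_multiplier hb f, Lp.coeFn_add (𝓕 (multiplier a f) : L2) (𝓕 (multiplier b f))]
    with ξ h1 h2 h3 h4
  rw [h4, Pi.add_apply, h2, h3, ← add_mul]
  exact h1

/-- Duality: the form is tested on the restricted output itself, and each L¹ norm costs a factor V.
-/
theorem norm_restrict_le_of_inner_le {R V K : ℝ} {T : L2 →L[ℂ] L2} (hK : 0 ≤ K) (hV : 0 ≤ V)
    (hV' : ∀ w : L2Ball R, ∫ x, ‖extendByZero w x‖ ≤ V * ‖w‖)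
    (hT : ∀ f h : L2, Integrable f → Integrable h →
      ‖inner ℂ h (T f)‖ ≤ K * (∫ x, ‖f x‖) * ∫ x, ‖h x‖) (w : L2Ball R) :
    ‖restrictBall R (T (extendByZero w))‖ ≤ K * V ^ 2 * ‖w‖ := by
  set u := restrictBall R (T (extendByZero w)) with hu
  have h := hT (extendByZero w) (extendByZero u) (integrable_extendByZero _) (integrable_extendByZero _)
  rw [inner_extendByZero, ← hu, inner_self_eq_norm_sq_to_K] at h
  have h1 : ‖u‖ * ‖u‖ ≤ (K * V ^ 2 * ‖w‖) * ‖u‖ := by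
    calc ‖u‖ * ‖u‖ ≤ _ := by simpa [← pow_two] using h
      _ ≤ K * (V * ‖w‖) * (V * ‖u‖) := by
        gcongr
        · exact hV' w
        · exact hV' u
      _ = _ := by ring
  rcases (norm_nonneg u).eq_or_lt with h0 | h0
  · rw [← h0]; positivity
  · exact le_of_mul_le_mul_right h1 h0

/-- The low frequencies go through the bounded Green function and cost |λ|^{n-1}; the high ones go
through the multiplier norm and cost |λ|^{n-4}. The constant is chosen before λ and c, so it is
uniform up to the spectrum. -/
theorem exists_norm_restrict_derivResolvent_le (R : ℝ) {l : List (Fin 3)} (hl : l.length ≤ 4) :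
    ∃ C : ℝ, 0 ≤ C ∧ ∀ lam : ℂ, 0 < lam.re → 0 < lam.im → ∀ c : ℝ, 0 < c →
      (∀ t : ℝ, 0 ≤ t → c ≤ ‖(t : ℂ) - lam ^ 4‖) → ∀ w : L2Ball R,
        ‖restrictBall R (derivResolvent l (lam ^ 4) (extendByZero w))‖ ≤
          C * (‖lam‖ ^ l.length * (1 / ‖lam‖ + 1 / ‖lam‖ ^ 4)) * ‖w‖ := by
  obtain ⟨V, hV, hV'⟩ := exists_integral_norm_extendByZero_le R
  set Q : ℝ := ∫ v, ‖𝓕 (lowSymbol l) v‖ with hQdef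
  have hQ : 0 ≤ Q := integral_nonneg fun _ => norm_nonneg _
  refine ⟨Q * V ^ 2 + 2, by positivity, fun lam hre him c hc hz w => ?_⟩
  have h0 : 0 < ‖lam‖ := norm_pos_iff.2 (by rintro rfl; simp at hre)
  set s := ‖lam‖ with hs
  set a : E3 → ℂ := fun ξ => scaledLowSymbol l s ξ * 𝓕 (green lam) ξ with hadef
  set b : E3 → ℂ := fun ξ => (derivSymbol l ξ - scaledLowSymbol l s ξ) * resolventSymbol (lam ^ 4) ξ
    with hbdef
  have hmul := memLp_deriv_mul_resolventSymbol hc hz hl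
  have hcut : Continuous fun ξ : E3 => ((frequencyCutoff (s⁻¹ • ξ) : ℝ) : ℂ) :=
    Complex.continuous_ofReal.comp (frequencyCutoff.continuous.comp (continuous_const_smul _))
  have hlow : Continuous (scaledLowSymbol l s) := (contDiff_derivSymbol l).continuous.mul hcut
  have hb : MemLp b ⊤ (volume : Measure E3) :=
    memLp_top_of_bound (((contDiff_derivSymbol l).continuous.sub hlow).measurable.mul
      (measurable_resolventSymbol _)).aestronglyMeasurable _
      (.of_forall (norm_high_symbol_le hl h0))
  have hab : (fun ξ => a ξ + b ξ) = fun ξ => derivSymbol l ξ * resolventSymbol (lam ^ 4) ξ := by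
    ext ξ
    simp only [hadef, hbdef, fourier_green hre him]
    ring
  -- The low part is bounded as the difference of the full symbol and the high part; no quantitative
  -- bound is needed here.
  have ha : MemLp a ⊤ (volume : Measure E3) := by
    convert! hmul.sub hb using 1
    rw [← hab]
    ext ξ
    simp
  have e : derivResolvent l (lam ^ 4) (extendByZero w) =
      multiplier a (extendByZero w) + multiplier b (extendByZero w) := by
    rw [derivResolvent, ← hab]
    exact multiplier_add ha hb _
  have h1 := norm_restrict_le_of_inner_le (R := R) (V := V) (T := multiplier a)
    (K := 1 / (4 * Real.pi * s) * (s ^ l.length * Q)) (by positivity) hV hV' (fun f h hf hh => by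
      have := norm_inner_multiplier_le (integrable_scaledLowSymbol l h0)
        (integrable_fourier_scaledLowSymbol l h0) (integrable_green hre him) (norm_green_le hre him)
        ha f h hf hh
      rwa [integral_norm_fourier_scaledLowSymbol l h0] at this) w
  have h2 : ‖restrictBall R (multiplier b (extendByZero w))‖ ≤ 2 * (s ^ l.length / s ^ 4) * ‖w‖ := by
    refine (norm_restrictBall_apply_le _ _).trans ?_
    refine (norm_multiplier_apply_le hb (norm_high_symbol_le hl h0) _).trans ?_
    gcongr
    exact norm_extendByZero_le w
  have hpi : 1 / (4 * Real.pi * s) ≤ 1 / s := by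
    gcongr
    nlinarith [Real.pi_gt_three]
  rw [e, map_add]
  refine (norm_add_le _ _).trans ((add_le_add h1 h2).trans ?_)
  rw [← add_mul]
  gcongr
  calc _ ≤ 1 / s * (s ^ l.length * Q) * V ^ 2 + 2 * (s ^ l.length / s ^ 4) := by gcongr
    _ = s ^ l.length * (Q * V ^ 2 * (1 / s) + 2 * (1 / s ^ 4)) := by ring
    _ ≤ s ^ l.length * ((Q * V ^ 2 + 2) * (1 / s) + (Q * V ^ 2 + 2) * (1 / s ^ 4)) := by
      gcongr
      · linarith
      · nlinarith [mul_nonneg hQ (sq_nonneg V)]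
    _ = _ := by ring

/-! ### Weak derivatives of the cut-off resolvent -/

/-- The partial derivative `∂/∂x_i` of a complex test function. -/
def cpderiv {R : ℝ} (i : Fin 3) (ρ : 𝓓(ballOpen R, ℂ)) : 𝓓(ballOpen R, ℂ) :=
  ∂_{(EuclideanSpace.single i (1 : ℝ) : E3)} ρ

theorem pderiv_apply {R : ℝ} (i : Fin 3) (φ : 𝓓(ballOpen R, ℝ)) (x : E3) :
    pderiv i φ x = fderiv ℝ φ x (EuclideanSpace.single i 1) := by
  rw [pderiv, TestFunction.lineDerivOp_eq_lineDerivCLM ℝ, TestFunction.lineDerivCLM_eq_fderivCLM,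
    TestFunction.fderivCLM_apply_of_le _ (by simp)]

theorem cpderiv_apply {R : ℝ} (i : Fin 3) (ρ : 𝓓(ballOpen R, ℂ)) (x : E3) :
    cpderiv i ρ x = fderiv ℝ ρ x (EuclideanSpace.single i 1) := by
  rw [cpderiv, TestFunction.lineDerivOp_eq_lineDerivCLM ℝ, TestFunction.lineDerivCLM_eq_fderivCLM,
    TestFunction.fderivCLM_apply_of_le _ (by simp)]

theorem testFunction_eq_zero {R : ℝ} (ρ : 𝓓(ballOpen R, ℂ)) {x : E3} (hx : x ∉ ball (0 : E3) R) :
    ρ x = 0 :=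
  image_eq_zero_of_notMem_tsupport fun h => hx (ρ.tsupport_subset h)

theorem testFunction_memLp (R : ℝ) (ρ : 𝓓(ballOpen R, ℂ)) : MemLp ρ ⊤ (volume : Measure E3) :=
  ρ.memLp_top

theorem integrable_real_mul_test_mul {R : ℝ} (φ : 𝓓(ballOpen R, ℝ)) (ρ : 𝓓(ballOpen R, ℂ)) (u : L2) :
    Integrable fun x => φ x • (ρ x * u x) := by
  have hu : LocallyIntegrable (u : E3 → ℂ) := (Lp.memLp u).locallyIntegrable (by norm_num)
  have h := (hu.continuous_mul ρ.continuous).integrable_smul_left_of_hasCompactSupport φ.continuous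
    φ.hasCompactSupport
  exact h

/-- The distributional derivative of u is tested on the product φρ, which is smooth with compact
support. -/
theorem integral_pderiv_smul_mul {R : ℝ} (i : Fin 3) (φ : 𝓓(ballOpen R, ℝ)) (ρ : 𝓓(ballOpen R, ℂ))
    {u v : L2} (h : ∂_{(EuclideanSpace.single i (1 : ℝ) : E3)} (u : 𝓢'(E3, ℂ)) = (v : 𝓢'(E3, ℂ))) :
    ∫ x, pderiv i φ x • (ρ x * u x) =
      -((∫ x, φ x • (cpderiv i ρ x * u x)) + ∫ x, φ x • (ρ x * v x)) := by
  have hφ : ContDiff ℝ ∞ φ := φ.contDiff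
  have hρ : ContDiff ℝ ∞ ρ := ρ.contDiff
  have hΨ : ContDiff ℝ ∞ fun x => φ x • ρ x := hφ.smul hρ
  have hc : HasCompactSupport fun x => φ x • ρ x := φ.hasCompactSupport.smul_right
  have e := congrArg (fun T : 𝓢'(E3, ℂ) => T (hc.toSchwartzMap hΨ)) h
  simp only [TemperedDistribution.lineDerivOp_apply_apply, Lp.toTemperedDistribution_apply,
    neg_apply, SchwartzMap.lineDerivOp_apply_eq_fderiv] at e
  have d : ∀ x, fderiv ℝ (hc.toSchwartzMap hΨ) x (EuclideanSpace.single i 1) =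
      φ x • cpderiv i ρ x + pderiv i φ x • ρ x := by
    intro x
    have h1 : DifferentiableAt ℝ φ x := (hφ.differentiable (by simp)) x
    have h2 : DifferentiableAt ℝ ρ x := (hρ.differentiable (by simp)) x
    change fderiv ℝ (fun x => φ x • ρ x) x _ = _
    rw [fderiv_fun_smul h1 h2, cpderiv_apply, pderiv_apply]
    simp
  simp only [d] at e
  have hv : ∫ x, φ x • (ρ x * v x) = -((∫ x, φ x • (cpderiv i ρ x * u x)) + ∫ x, pderiv i φ x • (ρ x * u x)) := by
    rw [← integral_add (integrable_real_mul_test_mul _ _ _) (integrable_real_mul_test_mul _ _ _),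
      ← integral_neg]
    refine Eq.trans ?_ (e.symm.trans ?_)
    · refine integral_congr_ae (.of_forall fun x => ?_)
      change φ x • (ρ x * v x) = (φ x • ρ x) • v x
      simp only [Complex.real_smul, smul_eq_mul]; ring
    · refine integral_congr_ae (.of_forall fun x => ?_)
      simp only [Complex.real_smul, smul_eq_mul]; ring
  rw [hv]
  ring

/-- The Leibniz expansion of `f ↦ ∂_l (ρ ∂_β (Δ² - z)⁻¹ f)` on `B_R`. -/
def leibnizOp {R : ℝ} (z : ℂ) :
    List (Fin 3) → List (Fin 3) → 𝓓(ballOpen R, ℂ) → (L2 →L[ℂ] L2Ball R)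
  | [], β, ρ => restrictBall R ∘L mulOp ρ ∘L derivResolvent β z
  | i :: l, β, ρ => leibnizOp z l β (cpderiv i ρ) + leibnizOp z l (i :: β) ρ

theorem coeFn_leibnizOp_nil {R : ℝ} (z : ℂ) (β : List (Fin 3)) (ρ : 𝓓(ballOpen R, ℂ)) (f : L2) :
    leibnizOp z [] β ρ f =ᵐ[volume.restrict (ball (0 : E3) R)]
      fun x => ρ x * derivResolvent β z f x := by
  change restrictBall R (mulOp ρ (derivResolvent β z f)) =ᵐ[_] _
  filter_upwards [coeFn_restrictBall R (mulOp ρ (derivResolvent β z f)),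
    ae_restrict_of_ae (coeFn_mulOp (testFunction_memLp R ρ) (derivResolvent β z f))] with x h1 h2
  rw [h1, h2]

theorem setIntegral_leibnizOp_nil {R : ℝ} (z : ℂ) (β : List (Fin 3)) (ρ : 𝓓(ballOpen R, ℂ)) (f : L2)
    (φ : 𝓓(ballOpen R, ℝ)) :
    ∫ x in ball (0 : E3) R, φ x • leibnizOp z [] β ρ f x =
      ∫ x, φ x • (ρ x * derivResolvent β z f x) := by
  rw [← setIntegral_eq_integral_of_forall_compl_eq_zero (s := ball (0 : E3) R)
    (f := fun x => φ x • (ρ x * derivResolvent β z f x)) (fun x hx => by rw [testFunction_eq_zero ρ hx]; simp)]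
  refine integral_congr_ae ?_
  filter_upwards [coeFn_leibnizOp_nil z β ρ f] with x hx
  rw [hx]

theorem setIntegral_smul_add {R : ℝ} (φ : 𝓓(ballOpen R, ℝ)) (u v : L2Ball R) :
    ∫ x in ball (0 : E3) R, φ x • (u + v : L2Ball R) x =
      (∫ x in ball (0 : E3) R, φ x • u x) + ∫ x in ball (0 : E3) R, φ x • v x := by
  rw [← integral_add (integrable_test_smul φ u) (integrable_test_smul φ v)]
  refine integral_congr_ae ?_
  filter_upwards [Lp.coeFn_add u v] with x hx
  rw [hx, Pi.add_apply, smul_add]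

/-- One integration by parts per step: the derivative falls either on ρ or on the resolvent, so the
induction must range over all ρ and β. The bound 4 on the total order keeps every multiplier
bounded. -/
theorem setIntegral_foldr_pderiv_leibnizOp {R : ℝ} {z : ℂ} {c : ℝ} (hc : 0 < c)
    (hz : ∀ t : ℝ, 0 ≤ t → c ≤ ‖(t : ℂ) - z‖) (φ : 𝓓(ballOpen R, ℝ)) (f : L2)
    (l : List (Fin 3)) : ∀ (β : List (Fin 3)) (ρ : 𝓓(ballOpen R, ℂ)), l.length + β.length ≤ 4 →
    ∫ x in ball (0 : E3) R, (l.foldr pderiv φ) x • leibnizOp z [] β ρ f x =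
      (-1 : ℂ) ^ l.length * ∫ x in ball (0 : E3) R, φ x • leibnizOp z l β ρ f x := by
  induction l with
  | nil => intro β ρ _; simp
  | cons i l ih =>
    intro β ρ hlen
    rw [List.length_cons] at hlen
    have h1 := lineDeriv_derivResolvent hc hz (l := β) i (by omega) f
    rw [List.foldr_cons, setIntegral_leibnizOp_nil, integral_pderiv_smul_mul i _ ρ h1,
      ← setIntegral_leibnizOp_nil, ← setIntegral_leibnizOp_nil, ih β (cpderiv i ρ) (by omega),
      ih (i :: β) ρ (by rw [List.length_cons]; omega)]
    have e : leibnizOp z (i :: l) β ρ f = leibnizOp z l β (cpderiv i ρ) f + leibnizOp z l (i :: β) ρ f := rfl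
    rw [e, setIntegral_smul_add, List.length_cons, pow_succ]
    ring

/-- The correction factor acts on the right, so it passes unchanged through all the terms of the
Leibniz expansion. -/
theorem leibnizOp_eq_comp {R : ℝ} {z w : ℂ} {c c' : ℝ} (hc : 0 < c)
    (hz : ∀ t : ℝ, 0 ≤ t → c ≤ ‖(t : ℂ) - z‖) (hc' : 0 < c')
    (hw : ∀ t : ℝ, 0 ≤ t → c' ≤ ‖(t : ℂ) - w‖) (l : List (Fin 3)) :
    ∀ (β : List (Fin 3)) (ρ : 𝓓(ballOpen R, ℂ)), l.length + β.length ≤ 4 →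
      leibnizOp z l β ρ = leibnizOp w l β ρ ∘L (1 + (z - w) • derivResolvent [] z) := by
  induction l with
  | nil =>
    intro β ρ hlen
    simp only [leibnizOp]
    rw [derivResolvent_eq_comp hc hz hc' hw (l := β) (by simpa using hlen)]
    rfl
  | cons i l ih =>
    intro β ρ hlen
    rw [List.length_cons] at hlen
    simp only [leibnizOp]
    rw [ih β _ (by omega), ih (i :: β) ρ (by rw [List.length_cons]; omega),
      ContinuousLinearMap.add_comp]

theorem exists_norm_test_le {R : ℝ} (ρ : 𝓓(ballOpen R, ℂ)) : ∃ M : ℝ, 0 ≤ M ∧ ∀ x, ‖ρ x‖ ≤ M := by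
  obtain ⟨M, hM⟩ := ρ.hasCompactSupport.exists_bound_of_continuous ρ.continuous
  exact ⟨M, (norm_nonneg _).trans (hM 0), hM⟩

theorem norm_restrict_mulOp_le {R M : ℝ} {ρ : 𝓓(ballOpen R, ℂ)} (hM : ∀ x, ‖ρ x‖ ≤ M) (v : L2) :
    ‖restrictBall R (mulOp ρ v)‖ ≤ M * ‖restrictBall R v‖ := by
  refine Lp.norm_le_mul_norm_of_ae_le_mul ?_
  filter_upwards [coeFn_restrictBall R (mulOp ρ v), coeFn_restrictBall R v,
    ae_restrict_of_ae (coeFn_mulOp (testFunction_memLp R ρ) v)] with x h1 h2 h3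
  rw [h1, h2, h3, norm_mul]
  gcongr
  exact hM x

/-- Since s is bounded below by a, lower powers and the negative powers of s are absorbed into s^N.
-/
theorem pow_mul_inv_add_le {a s : ℝ} (ha : 0 < a) (has : a ≤ s) {n N : ℕ} (hn : n ≤ N) :
    s ^ n * (1 / s + 1 / s ^ 4) ≤ (1 / a ^ (N - n) * (1 / a + 1 / a ^ 4)) * s ^ N := by
  obtain ⟨m, rfl⟩ := Nat.exists_eq_add_of_le hn
  have hs : 0 < s := ha.trans_le has
  rw [Nat.add_sub_cancel_left, pow_add]
  have h1 : 1 ≤ 1 / a ^ m * s ^ m := by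
    rw [one_div_mul_eq_div, one_le_div (by positivity)]
    gcongr
  calc s ^ n * (1 / s + 1 / s ^ 4) ≤ s ^ n * (1 / a + 1 / a ^ 4) := by gcongr
    _ ≤ (1 / a ^ m * s ^ m) * (s ^ n * (1 / a + 1 / a ^ 4)) := le_mul_of_one_le_left (by positivity) h1
    _ = _ := by ring

theorem exists_norm_leibnizOp_le {R a : ℝ} (ha : 0 < a) {N : ℕ} (hN : N ≤ 4) (l : List (Fin 3)) :
    ∀ (β : List (Fin 3)) (ρ : 𝓓(ballOpen R, ℂ)), l.length + β.length ≤ N →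
      ∃ C : ℝ, 0 ≤ C ∧ ∀ lam : ℂ, a ≤ ‖lam‖ → 0 < lam.re → 0 < lam.im → ∀ c : ℝ, 0 < c →
        (∀ t : ℝ, 0 ≤ t → c ≤ ‖(t : ℂ) - lam ^ 4‖) → ∀ w : L2Ball R,
          ‖leibnizOp (lam ^ 4) l β ρ (extendByZero w)‖ ≤ C * ‖lam‖ ^ N * ‖w‖ := by
  induction l with
  | nil =>
    intro β ρ hlen
    rw [List.length_nil, zero_add] at hlen
    obtain ⟨M, hM, hM'⟩ := exists_norm_test_le ρ
    obtain ⟨C, hC, hC'⟩ := exists_norm_restrict_derivResolvent_le R (l := β) (hlen.trans hN)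
    refine ⟨M * (C * (1 / a ^ (N - β.length) * (1 / a + 1 / a ^ 4))), by positivity,
      fun lam hal hre him c hc hz w => ?_⟩
    refine (norm_restrict_mulOp_le hM' _).trans ?_
    have h1 := hC' lam hre him c hc hz w
    have h2 := pow_mul_inv_add_le ha hal hlen
    calc _ ≤ M * (C * ((1 / a ^ (N - β.length) * (1 / a + 1 / a ^ 4)) * ‖lam‖ ^ N) * ‖w‖) := by
          gcongr
          refine h1.trans ?_
          gcongr
      _ = _ := by ring
  | cons i l ih =>
    intro β ρ hlen
    rw [List.length_cons] at hlen
    obtain ⟨C₁, h₁, h₁'⟩ := ih β (cpderiv i ρ) (by omega)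
    obtain ⟨C₂, h₂, h₂'⟩ := ih (i :: β) ρ (by rw [List.length_cons]; omega)
    refine ⟨C₁ + C₂, by positivity, fun lam hal hre him c hc hz w => ?_⟩
    refine (norm_add_le _ _).trans ?_
    rw [add_mul, add_mul]
    exact add_le_add (h₁' lam hal hre him c hc hz w) (h₂' lam hal hre him c hc hz w)

/-- The list of directions of the derivative `∂^α`. -/
def MultiIndex.toList {j : ℕ} (α : MultiIndex j) : List (Fin 3) :=
  List.replicate (α.1 0) 0 ++ (List.replicate (α.1 1) 1 ++ List.replicate (α.1 2) 2)

theorem MultiIndex.length_toList {j : ℕ} (α : MultiIndex j) : α.toList.length = α.order := by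
  simp [MultiIndex.toList, MultiIndex.order, Fin.sum_univ_three, add_assoc]

theorem foldr_replicate_pderiv {R : ℝ} (n : ℕ) (i : Fin 3) (φ : 𝓓(ballOpen R, ℝ)) :
    (List.replicate n i).foldr pderiv φ = (pderiv i)^[n] φ := by
  induction n with
  | zero => rfl
  | succ n ih => rw [List.replicate_succ, List.foldr_cons, ih, Function.iterate_succ_apply']

theorem foldr_toList_pderiv {R : ℝ} {j : ℕ} (α : MultiIndex j) (φ : 𝓓(ballOpen R, ℝ)) :
    α.toList.foldr pderiv φ = mderiv α φ := by
  simp only [MultiIndex.toList, List.foldr_append, foldr_replicate_pderiv, mderiv]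

/-- The map `f ↦ ρ (Δ² - z)⁻¹ f` from `L²(ℝ³)` to `H^j(B_R)`. -/
def sobolevOp {R : ℝ} (ρ : 𝓓(ballOpen R, ℂ)) {j : ℕ} (hj : j ≤ 4) {z : ℂ} {c : ℝ} (hc : 0 < c)
    (hz : ∀ t : ℝ, 0 ≤ t → c ≤ ‖(t : ℂ) - z‖) : L2 →L[ℂ] sobolevBall R j :=
  (((PiLp.continuousLinearEquiv 2 ℂ (fun _ : MultiIndex j => L2Ball R)).symm :
      (MultiIndex j → L2Ball R) →L[ℂ] PiLp 2 (fun _ : MultiIndex j => L2Ball R)) ∘L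
    ContinuousLinearMap.pi fun α : MultiIndex j => leibnizOp z α.toList [] ρ).codRestrict
    (sobolevBall R j) (by
      intro f α φ
      have h := setIntegral_foldr_pderiv_leibnizOp hc hz φ f α.toList [] ρ (by
        rw [α.length_toList, List.length_nil, add_zero]; exact α.2.trans hj)
      rw [foldr_toList_pderiv, α.length_toList] at h
      exact h)

theorem norm_piLp_le_sum {ι : Type*} [Fintype ι] {E : ι → Type*} [∀ i, NormedAddCommGroup (E i)]
    (x : PiLp 2 E) : ‖x‖ ≤ ∑ i, ‖x i‖ := by
  rw [PiLp.norm_eq_of_L2]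
  refine Real.sqrt_le_iff.2 ⟨Finset.sum_nonneg fun _ _ => norm_nonneg _, ?_⟩
  exact Finset.sum_sq_le_sq_sum_of_nonneg fun _ _ => norm_nonneg _

/-! ### The damped plate resolvent -/

theorem mulTest_eq_mulOp {R : ℝ} (ρ : 𝓓(ballOpen R, ℂ)) (u : L2) : mulTest ρ u = mulOp ρ u := by
  refine Lp.ext ?_
  filter_upwards [Lp.coeFn_lpSMul (r := 2) ((ρ.memLp_top (μ := (volume : Measure E3))).toLp ρ) u,
    (ρ.memLp_top (μ := (volume : Measure E3))).coeFn_toLp, coeFn_mulOp (testFunction_memLp R ρ) u]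
    with x h1 h2 h3
  rw [h3, ← h2]
  exact h1

/-- Since ρ vanishes off the ball, the product is again an extension by zero, the form of input that
the local estimates require. -/
theorem mulOp_extendByZero {R : ℝ} (ρ : 𝓓(ballOpen R, ℂ)) (w : L2Ball R) :
    mulOp ρ (extendByZero w) = extendByZero (restrictBall R (mulOp ρ (extendByZero w))) := by
  refine Lp.ext ?_
  have h : ∀ᵐ x : E3, x ∈ ball (0 : E3) R →
      restrictBall R (mulOp ρ (extendByZero w)) x = mulOp ρ (extendByZero w) x :=
    (ae_restrict_iff' measurableSet_ball).1 (coeFn_restrictBall R _)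
  filter_upwards [coeFn_mulOp (testFunction_memLp R ρ) (extendByZero w),
    coeFn_extendByZero (restrictBall R (mulOp ρ (extendByZero w))), h] with x h1 h2 h3
  rw [h2]
  by_cases hx : x ∈ ball (0 : E3) R
  · rw [indicator_of_mem hx, h3 hx]
  · rw [indicator_of_notMem hx, h1, testFunction_eq_zero ρ hx, zero_mul]

theorem norm_restrict_mulOp_extendByZero_le {R M : ℝ} (hM0 : 0 ≤ M) {ρ : 𝓓(ballOpen R, ℂ)}
    (hM : ∀ x, ‖ρ x‖ ≤ M) (w : L2Ball R) :
    ‖restrictBall R (mulOp ρ (extendByZero w))‖ ≤ M * ‖w‖ := by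
  refine (norm_restrict_mulOp_le hM _).trans ?_
  gcongr
  exact (norm_restrictBall_apply_le _ _).trans (norm_extendByZero_le w)

theorem im_plate (σ : ℝ) (k : ℂ) :
    (k ^ 2 + Complex.I * k * σ).im = k.re * (2 * k.im + σ) := by
  simp [pow_two]
  ring

/-- On the slab 2 Im k + σ > σ - 2d ≥ σ/2. -/
theorem im_plate_pos {δ σ d : ℝ} (hδ : 0 < δ) (hσ : 0 < σ) (hd : d ≤ σ / 4) {k : ℂ}
    (hk : k ∈ slab δ d) : 0 < (k ^ 2 + Complex.I * k * σ).im := by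
  obtain ⟨h1, h2, -⟩ := hk
  rw [im_plate]
  exact mul_pos (hδ.trans h1) (by linarith)

theorem plateResolvent_eq {σ : ℝ} {k : ℂ} (h : (k ^ 2 + Complex.I * k * σ).im ≠ 0) :
    plateResolvent σ k = derivResolvent [] (k ^ 2 + Complex.I * k * σ) :=
  biharmonicResolvent_eq
    (isResolventAt_derivResolvent (abs_pos.2 h) fun t _ => le_norm_sub_of_im_pos t)

theorem isResolventAt_plateResolvent {σ : ℝ} {k : ℂ} (h : (k ^ 2 + Complex.I * k * σ).im ≠ 0) :
    IsResolventAt (k ^ 2 + Complex.I * k * σ) (plateResolvent σ k) := by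
  rw [plateResolvent_eq h]
  exact isResolventAt_derivResolvent (abs_pos.2 h) fun t _ => le_norm_sub_of_im_pos t

theorem analyticAt_plateResolvent {σ : ℝ} {k : ℂ} (h : (k ^ 2 + Complex.I * k * σ).im ≠ 0) :
    AnalyticAt ℂ (fun k : ℂ => plateResolvent σ k) k := by
  have hc : Continuous fun k : ℂ => (k ^ 2 + Complex.I * k * σ).im := by fun_prop
  have e : (fun k : ℂ => derivResolvent [] (k ^ 2 + Complex.I * k * σ)) =ᶠ[nhds k]
      fun k => plateResolvent σ k := by
    filter_upwards [hc.continuousAt.eventually_ne h] with k' hk'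
    exact (plateResolvent_eq hk').symm
  refine AnalyticAt.congr ?_ e
  refine AnalyticAt.fun_comp (f := fun k : ℂ => k ^ 2 + Complex.I * k * σ)
    (analyticAt_derivResolvent h) ?_
  fun_prop

/-- The principal fourth root has argument in (0, π/4]. The open first quadrant is what makes both
e^{iλr} and e^{-λr} decay. -/
theorem exists_pow_four_eq {z : ℂ} (hz : 0 < z.im) :
    ∃ lam : ℂ, lam ^ 4 = z ∧ 0 < lam.re ∧ 0 < lam.im := by
  have hz0 : z ≠ 0 := by rintro rfl; simp at hz
  have ha0 : 0 < z.arg := by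
    refine lt_of_le_of_ne (Complex.arg_nonneg_iff.2 hz.le) fun h => ?_
    have := (Complex.arg_eq_zero_iff.1 h.symm).2
    linarith
  have ha1 := Complex.arg_le_pi z
  have hdiv : (Complex.log z / 4).im = z.arg / 4 := by
    rw [Complex.div_ofNat_im, Complex.log_im]
  refine ⟨Complex.exp (Complex.log z / 4), ?_, ?_, ?_⟩
  · rw [← Complex.exp_nat_mul]
    push_cast
    rw [mul_div_cancel₀ _ (by norm_num : (4 : ℂ) ≠ 0), Complex.exp_log hz0]
  · rw [Complex.exp_re]
    refine mul_pos (Real.exp_pos _) (Real.cos_pos_of_mem_Ioo ⟨?_, ?_⟩) <;>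
      rw [hdiv] <;> linarith
  · rw [Complex.exp_im]
    refine mul_pos (Real.exp_pos _) (Real.sin_pos_of_pos_of_lt_pi ?_ ?_) <;>
      rw [hdiv] <;> linarith

/-- The point -1 lies at distance 1 from [0, ∞) and serves as a base point independent of k. -/
theorem le_norm_add_one (t : ℝ) (ht : 0 ≤ t) : (1 : ℝ) ≤ ‖(t : ℂ) - (-1)‖ := by
  rw [sub_neg_eq_add, ← Complex.ofReal_one, ← Complex.ofReal_add, Complex.norm_real,
    Real.norm_of_nonneg (by linarith)]
  linarith

/-- The cut-off resolvent `ρ R(k) ρ` as an operator `L²(B_R) → H^j(B_R)`. -/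
def cutoffSobolev {R : ℝ} (ρ : 𝓓(ballOpen R, ℂ)) {j : ℕ} (hj : j ≤ 4) (σ : ℝ) (k : ℂ) :
    L2Ball R →L[ℂ] sobolevBall R j :=
  (sobolevOp ρ hj one_pos le_norm_add_one ∘L
    (1 + (k ^ 2 + Complex.I * k * σ - (-1)) • plateResolvent σ k)) ∘L (mulOp ρ ∘L extendCLM R)

/-- The factorisation through the base point confines the dependence on k to R(k) on L² and a
scalar; the resolvent identity recovers the Leibniz expansion at z itself, to which the estimates
apply. -/
theorem cutoffSobolev_apply {R : ℝ} (ρ : 𝓓(ballOpen R, ℂ)) {j : ℕ} (hj : j ≤ 4) {σ : ℝ} {k : ℂ}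
    (h : (k ^ 2 + Complex.I * k * σ).im ≠ 0) (g : L2Ball R) (α : MultiIndex j) :
    (cutoffSobolev ρ hj σ k g : PiLp 2 (fun _ : MultiIndex j => L2Ball R)) α =
      leibnizOp (k ^ 2 + Complex.I * k * σ) α.toList [] ρ (mulOp ρ (extendByZero g)) := by
  have e := leibnizOp_eq_comp (abs_pos.2 h) (fun t _ => le_norm_sub_of_im_pos t) one_pos
    le_norm_add_one α.toList [] ρ (by
      rw [α.length_toList, List.length_nil, add_zero]; exact α.2.trans hj)
  rw [e, ← plateResolvent_eq h, ← extendCLM_apply]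
  rfl

theorem sobolevToL2_cutoffSobolev {R : ℝ} (ρ : 𝓓(ballOpen R, ℂ)) {j : ℕ} (hj : j ≤ 4) {σ : ℝ}
    {k : ℂ} (h : (k ^ 2 + Complex.I * k * σ).im ≠ 0) (g : L2Ball R) :
    sobolevToL2 (cutoffSobolev ρ hj σ k g) = cutoffResolvent ρ σ k g := by
  rw [sobolevToL2, cutoffSobolev_apply ρ hj h, cutoffResolvent, mulTest_eq_mulOp, mulTest_eq_mulOp,
    plateResolvent_eq h]
  rfl

theorem analyticAt_comp_comp {E F G H : Type*} [NormedAddCommGroup E] [NormedSpace ℂ E]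
    [NormedAddCommGroup F] [NormedSpace ℂ F] [NormedAddCommGroup G] [NormedSpace ℂ G]
    [NormedAddCommGroup H] [NormedSpace ℂ H] (S : G →L[ℂ] H) (B : E →L[ℂ] F)
    {T : ℂ → F →L[ℂ] G} {k : ℂ} (hT : AnalyticAt ℂ T k) :
    AnalyticAt ℂ (fun z => (S ∘L T z) ∘L B) k :=
  ((((ContinuousLinearMap.compL ℂ E F H).flip B) ∘L
    (ContinuousLinearMap.compL ℂ F G H S)).analyticAt _).comp hT

theorem analyticAt_cutoffSobolev {R : ℝ} (ρ : 𝓓(ballOpen R, ℂ)) {j : ℕ} (hj : j ≤ 4) {σ : ℝ}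
    {k : ℂ} (h : (k ^ 2 + Complex.I * k * σ).im ≠ 0) :
    AnalyticAt ℂ (cutoffSobolev ρ hj σ) k := by
  have hp : AnalyticAt ℂ (fun k : ℂ => k ^ 2 + Complex.I * k * σ - (-1)) k := by fun_prop
  have h1 : AnalyticAt ℂ (fun k : ℂ => (1 : L2 →L[ℂ] L2) +
      (k ^ 2 + Complex.I * k * σ - (-1)) • plateResolvent σ k) k :=
    analyticAt_const.fun_add (hp.fun_smul (analyticAt_plateResolvent h))
  exact analyticAt_comp_comp _ _ h1

theorem exists_norm_cutoffSobolev_le {R a : ℝ} (ha : 0 < a) (ρ : 𝓓(ballOpen R, ℂ)) {j : ℕ}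
    (hj : j ≤ 4) :
    ∃ C : ℝ, 0 ≤ C ∧ ∀ (σ : ℝ) (k lam : ℂ), lam ^ 4 = k ^ 2 + Complex.I * k * σ →
      0 < (k ^ 2 + Complex.I * k * σ).im → 0 < lam.re → 0 < lam.im → a ≤ ‖lam‖ →
        ‖cutoffSobolev ρ hj σ k‖ ≤ C * ‖lam‖ ^ j := by
  obtain ⟨M, hM, hM'⟩ := exists_norm_test_le ρ
  have hex := fun α : MultiIndex j => exists_norm_leibnizOp_le (R := R) ha hj α.toList [] ρ (by
    rw [α.length_toList, List.length_nil, add_zero]; exact α.2)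
  choose C hC hC' using hex
  refine ⟨(∑ α, C α) * M, mul_nonneg (Finset.sum_nonneg fun α _ => hC α) hM,
    fun σ k lam hlam him hre himl hal => ?_⟩
  have hS : 0 ≤ ∑ α, C α := Finset.sum_nonneg fun α _ => hC α
  refine ContinuousLinearMap.opNorm_le_bound _ (by positivity) fun g => ?_
  refine (norm_piLp_le_sum (cutoffSobolev ρ hj σ k g : PiLp 2 (fun _ : MultiIndex j => L2Ball R))).trans ?_
  have hw := norm_restrict_mulOp_extendByZero_le hM hM' g
  calc _ ≤ ∑ α, C α * ‖lam‖ ^ j * (M * ‖g‖) := by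
        refine Finset.sum_le_sum fun α _ => ?_
        rw [cutoffSobolev_apply ρ hj him.ne', mulOp_extendByZero, ← hlam]
        have hz : ∀ t : ℝ, 0 ≤ t → |(lam ^ 4).im| ≤ ‖(t : ℂ) - lam ^ 4‖ :=
          fun t _ => le_norm_sub_of_im_pos t
        refine (hC' α lam hal hre himl _ (abs_pos.2 (by rw [hlam]; exact him.ne')) hz _).trans ?_
        have := hC α
        gcongr
    _ = _ := by
        rw [← Finset.sum_mul, ← Finset.sum_mul]; ring

/-! ### From powers of λ to the bound in k and σ -/

/-- All three follow from |λ|⁴ = |k||k + iσ| with both real parts above δ; the upper bound uses σ ≤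
|k|σ/δ. -/
theorem norm_plate_lower {δ σ d : ℝ} (hδ : 0 < δ) {k lam : ℂ} (hk : k ∈ slab δ d)
    (hσ : 0 < σ) (hlam : lam ^ 4 = k ^ 2 + Complex.I * k * σ) :
    √δ ≤ ‖lam‖ ∧ ‖lam‖ ^ 4 ≤ ‖k‖ ^ 2 * (1 + σ / δ) ∧ δ ≤ ‖k‖ := by
  have hkd : δ ≤ ‖k‖ := hk.1.le.trans (Complex.re_le_norm k)
  have e : ‖lam‖ ^ 4 = ‖k‖ * ‖k + Complex.I * σ‖ := by
    rw [← norm_pow, hlam, ← norm_mul]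
    congr 1
    ring
  have h1 : δ ≤ ‖k + Complex.I * σ‖ := by
    refine le_trans ?_ (Complex.re_le_norm _)
    simpa using hk.1.le
  have h2 : ‖k + Complex.I * σ‖ ≤ ‖k‖ + σ := by
    refine (norm_add_le _ _).trans ?_
    simp [abs_of_pos hσ]
  refine ⟨?_, ?_, hkd⟩
  · refine le_of_pow_le_pow_left₀ (n := 4) (by norm_num) (norm_nonneg _) ?_
    rw [e, show (√δ) ^ 4 = (√δ ^ 2) * (√δ ^ 2) by ring, Real.sq_sqrt hδ.le]
    gcongr
  · rw [e]
    have : σ ≤ ‖k‖ * (σ / δ) := by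
      rw [mul_div_assoc', le_div_iff₀ hδ]
      nlinarith
    nlinarith [norm_nonneg k]

/-- Raise the hypothesis to the power j/4 ≤ 1; since b ≥ 1, the factor b^{j/4} is at most b. -/
theorem pow_le_of_pow_four_le {s κ b : ℝ} (hs : 0 ≤ s) (hκ : 0 ≤ κ) (hb : 1 ≤ b)
    (h : s ^ 4 ≤ κ ^ 2 * b) {j : ℕ} (hj : j ≤ 4) : s ^ j ≤ κ ^ ((j : ℝ) / 2) * b := by
  have hj' : (j : ℝ) ≤ 4 := by exact_mod_cast hj
  have e1 : s ^ j = (s ^ 4) ^ ((j : ℝ) / 4) := by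
    rw [← Real.rpow_natCast s 4, ← Real.rpow_mul hs, ← Real.rpow_natCast s j]
    congr 1
    push_cast
    ring
  have e2 : (κ ^ 2) ^ ((j : ℝ) / 4) = κ ^ ((j : ℝ) / 2) := by
    rw [← Real.rpow_natCast κ 2, ← Real.rpow_mul hκ]
    congr 1
    push_cast
    ring
  rw [e1]
  calc _ ≤ (κ ^ 2 * b) ^ ((j : ℝ) / 4) := by gcongr
    _ = κ ^ ((j : ℝ) / 2) * b ^ ((j : ℝ) / 4) := by
      rw [Real.mul_rpow (by positivity) (by linarith), e2]
    _ ≤ κ ^ ((j : ℝ) / 2) * b ^ (1 : ℝ) := by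
      gcongr
      · linarith
    _ = _ := by rw [Real.rpow_one]

/-- Because κ ≥ δ, the exponent is at least Bσ with B = 2R√δ, and e^x ≥ 1 + x dominates the linear
growth in σ with a constant depending on δ and R only. -/
theorem one_add_div_le_exp {δ R σ κ : ℝ} (hδ : 0 < δ) (hR : 0 < R) (hσ : 0 < σ) (hκ : δ ≤ κ) :
    1 + σ / δ ≤ (1 + 1 / (δ * (2 * R * √δ))) * Real.exp (2 * R * (σ + 1) * κ ^ ((1 : ℝ) / 2)) := by
  have hsδ : 0 < √δ := Real.sqrt_pos.2 hδ
  set B : ℝ := 2 * R * √δ with hB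
  have hB0 : 0 < B := by positivity
  have h1 : B * σ + 1 ≤ Real.exp (2 * R * (σ + 1) * κ ^ ((1 : ℝ) / 2)) := by
    refine (Real.add_one_le_exp _).trans (Real.exp_le_exp.2 ?_)
    rw [← Real.sqrt_eq_rpow]
    have : √δ ≤ √κ := Real.sqrt_le_sqrt hκ
    calc B * σ = 2 * R * σ * √δ := by rw [hB]; ring
      _ ≤ 2 * R * (σ + 1) * √κ := by gcongr; linarith
  calc 1 + σ / δ = 1 + 1 / (δ * B) * (B * σ) := by field_simp
    _ ≤ (1 + 1 / (δ * B)) * (B * σ + 1) := by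
      have : 0 ≤ 1 / (δ * B) := by positivity
      nlinarith [mul_pos hB0 hσ]
    _ ≤ _ := by gcongr

theorem exists_norm_cutoffSobolev_le_exp {δ R : ℝ} (hδ : 0 < δ) (hR : 0 < R)
    (ρ : 𝓓(ballOpen R, ℂ)) {j : ℕ} (hj : j ≤ 4) :
    ∃ C : ℝ, 0 ≤ C ∧ ∀ σ : ℝ, 0 < σ → ∀ d : ℝ, d ≤ σ / 4 → ∀ k ∈ slab δ d,
      ‖cutoffSobolev ρ hj σ k‖ ≤ C * (‖k‖ ^ ((j : ℝ) / 2) *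
        Real.exp (2 * R * (σ + 1) * ‖k‖ ^ ((1 : ℝ) / 2))) := by
  obtain ⟨C, hC, hC'⟩ := exists_norm_cutoffSobolev_le (Real.sqrt_pos.2 hδ) ρ hj
  refine ⟨C * (1 + 1 / (δ * (2 * R * √δ))), by positivity, fun σ hσ d hd k hk => ?_⟩
  have him := im_plate_pos hδ hσ hd hk
  obtain ⟨lam, hlam, hre, himl⟩ := exists_pow_four_eq him
  obtain ⟨h1, h2, h3⟩ := norm_plate_lower hδ hk hσ hlam
  have hb : 1 ≤ 1 + σ / δ := by
    have : 0 < σ / δ := by positivity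
    linarith
  have h4 := pow_le_of_pow_four_le (norm_nonneg lam) (norm_nonneg k) hb h2 hj
  have h5 := one_add_div_le_exp hδ hR hσ h3
  calc _ ≤ C * ‖lam‖ ^ j := hC' σ k lam hlam him hre himl h1
    _ ≤ C * (‖k‖ ^ ((j : ℝ) / 2) * ((1 + 1 / (δ * (2 * R * √δ))) *
        Real.exp (2 * R * (σ + 1) * ‖k‖ ^ ((1 : ℝ) / 2)))) := by
      gcongr
      exact h4.trans (by gcongr)
    _ = _ := by ring

end PlateResolvent

/-! ### The theorem -/

theorem mainTheorem7 (δ : ℝ) (hδ : 0 < δ) :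
    ∃ d₀ : ℝ → ℝ, (∀ σ : ℝ, 0 < σ → 0 < d₀ σ) ∧
      (∀ σ : ℝ, 0 < σ → ∀ d : ℝ, 0 < d → d ≤ d₀ σ →
        (∀ k ∈ PlateResolvent.slab δ d,
          PlateResolvent.IsResolventAt (k ^ 2 + Complex.I * k * σ)
            (PlateResolvent.plateResolvent σ k)) ∧
        AnalyticOnNhd ℂ (fun k : ℂ => PlateResolvent.plateResolvent σ k)
          (PlateResolvent.slab δ d)) ∧
      ∀ R : ℝ, 0 < R → ∀ ρ : 𝓓(PlateResolvent.ballOpen R, ℂ),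
        ∃ C : ℝ, 0 < C ∧ ∀ σ : ℝ, 0 < σ → ∀ d : ℝ, 0 < d → d ≤ d₀ σ → ∀ j : ℕ, j ≤ 4 →
          ∃ A : ℂ → (PlateResolvent.L2Ball R →L[ℂ] PlateResolvent.sobolevBall R j),
            (∀ k ∈ PlateResolvent.slab δ d, ∀ g : PlateResolvent.L2Ball R,
              PlateResolvent.sobolevToL2 (A k g) = PlateResolvent.cutoffResolvent ρ σ k g) ∧
            AnalyticOnNhd ℂ A (PlateResolvent.slab δ d) ∧
            ∀ k ∈ PlateResolvent.slab δ d,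
              ‖A k‖ ≤ C * ‖k‖ ^ ((j : ℝ) / 2) *
                Real.exp (2 * R * (σ + 1) * ‖k‖ ^ ((1 : ℝ) / 2)) := by
  refine ⟨fun σ => σ / 4, fun σ hσ => by positivity, fun σ hσ d _ hd =>
    ⟨fun k hk => PlateResolvent.isResolventAt_plateResolvent
      (PlateResolvent.im_plate_pos hδ hσ hd hk).ne',
    fun k hk => PlateResolvent.analyticAt_plateResolvent
      (PlateResolvent.im_plate_pos hδ hσ hd hk).ne'⟩, fun R hR ρ => ?_⟩
  have hex := fun j : Fin 5 => PlateResolvent.exists_norm_cutoffSobolev_le_exp hδ hR ρ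
    (Nat.lt_succ_iff.1 j.2)
  choose C hC hC' using hex
  have hS : 0 ≤ ∑ j, C j := Finset.sum_nonneg fun j _ => hC j
  -- Summing over the five orders makes the constant independent of j; the added 1 makes it strictly
  -- positive.
  refine ⟨∑ j, C j + 1, by positivity, fun σ hσ d _ hd j hj =>
    ⟨PlateResolvent.cutoffSobolev ρ hj σ, fun k hk g => PlateResolvent.sobolevToL2_cutoffSobolev ρ hj
      (PlateResolvent.im_plate_pos hδ hσ hd hk).ne' g, fun k hk =>
      PlateResolvent.analyticAt_cutoffSobolev ρ hj (PlateResolvent.im_plate_pos hδ hσ hd hk).ne',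
      fun k hk => ?_⟩⟩
  refine (hC' ⟨j, Nat.lt_succ_iff.2 hj⟩ σ hσ d hd k hk).trans ?_
  rw [← mul_assoc]
  gcongr
  have := Finset.single_le_sum (fun j _ => hC j) (Finset.mem_univ (⟨j, Nat.lt_succ_iff.2 hj⟩ : Fin 5))
  linarith

end
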